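/- **Pruning hardness with bounded total curvature.** Let $f\colon 2^N\to\mathbb R_{\ge 0}$ be a monotone submodular function on a finite set $N$. Write $f(x\mid A)=f(A\cup\{x\})-f(A)$. The total curvature of $f$ is $1-\min_{j} f(j\mid N\setminus\{j\})/f(\{j\})$, the minimum being over all $j\in N$ with $f(\{j\})\neq 0$ (and the curvature is $0$ if there is no such $j$). Write $\mathrm{OPT}_k(f)=\max_{|S|\le k}f(S)$. A (possibly randomized) pruning algorithm with budget $p$ adaptively queries values $f(S)$, $S\subseteq N$, and outputs a set $P\subseteq N$ with $|P|\le p$. Let $0<\kappa\le 1$, and let $\mathcal F_\kappa(N)$ be the class of non-negative monotone submodular functions on $2^N$ of total curvature at most $\kappa$; query and output bounds are required on all functions of the class under consideration. 1. (Hardness.) For every $\varepsilon>0$ and every polynomial $C$ with natural-number coefficients there is $k_0=k_0(\kappa,\varepsilon,C)$ such that for all $k\ge k_0$, all $p\ge k$, and $N$ with $|N|=\lceil 60p/\varepsilon\rceil$: for every randomized algorithm that makes at most $C(|N|)$ value queries and outputs $P$ with $|P|\le p$, there is $f\in\mathcal F_\kappa(N)$ with $$\mathbb E\Bigl[\max_{S\subseteq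 P,\ |S|\le k}f(S)\Bigr]<\Bigl(1-\frac{\kappa}{e}+\varepsilon\Bigr)\,\mathrm{OPT}_k(f).$$ In particular no polynomial-query algorithm has containment factor greater than $1-\kappa/e+\varepsilon$, whatever the pruning budget $p\ge k$. 2. (Tightness.) For every $\delta>0$ there is a polynomial $C$ such that for all $n,k$, all $p\ge k$, and $|N|=n$, some randomized algorithm makes at most $C(n)$ value queries, outputs $P$ with $|P|\le p$, and satisfies, for all $f\in\mathcal F_\kappa(N)$, $$\mathbb E\Bigl[\max_{S\subseteq P,\ |S|\le k}f(S)\Bigr]\ge\Bigl(1-\frac{\kappa}{e}-\delta\Bigr)\,\mathrm{OPT}_k(f).$$ 3. (Curvature zero.) Every $f\in\mathcal F_0(N)$ is modular, i.e. $f(A\cup B)+f(A\cap B)=f(A)+f(B)$ for all $A,B\subseteq N$. For all $n,k$, all $p\ge k$, and $|N|=n$, some deterministic algorithm, on every $f\in\mathcal F_0(N)$, makes at most $n$ value queries and outputs $P$ with $|P|\le p$ and $\max_{S\subseteq P,\,|S|\le k'}f(S)=\mathrm{OPT}_{k'}(f)$ for all $k'\le k$. -/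

import Mathlib

open MeasureTheory
open scoped Polynomial

/-! Set functions `f : 2^V → ℝ` on a finite ground set `V` are written `f : Finset V → ℝ`. -/

section SetFunctions

variable {V : Type} [Fintype V] [DecidableEq V]

/-- The marginal gain `f(x ∣ A) = f(A ∪ {x}) - f(A)`. -/
def marginalGain (f : Finset V → ℝ) (x : V) (A : Finset V) : ℝ :=
  f (insert x A) - f A

/-- Submodularity as diminishing returns. -/
def IsSubmodular (f : Finset V → ℝ) : Prop :=
  ∀ A B : Finset V, A ⊆ B → ∀ x : V, x ∉ B → marginalGain f x B ≤ marginalGain f x A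

/-- Modularity: equality in the lattice form of submodularity. -/
def IsModular (f : Finset V → ℝ) : Prop :=
  ∀ A B : Finset V, f (A ∪ B) + f (A ∩ B) = f A + f B

/-- The elements of non-zero singleton value, over which curvature ratios are taken. -/
noncomputable def curvatureSupport (f : Finset V → ℝ) : Finset V :=
  letI := Classical.decPred (fun j : V => f {j} ≠ 0)
  Finset.univ.filter (fun j : V => f {j} ≠ 0)

open Classical in
/-- The total curvature `1 - min_j f(j ∣ V \ {j}) / f({j})`. The minimum is over the elements with
`f({j}) ≠ 0`, where the ratio is defined; if there are none, the curvature is `0`. -/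
noncomputable def totalCurvature (f : Finset V → ℝ) : ℝ :=
  if h : (curvatureSupport f).Nonempty then
    1 - (curvatureSupport f).inf' h
      (fun j : V => marginalGain f j (Finset.univ.erase j) / f {j})
  else 0

/-- Non-negative monotone submodular functions of total curvature at most `κ`. -/
structure IsBoundedCurvature (κ : ℝ) (f : Finset V → ℝ) : Prop where
  nonneg : ∀ S : Finset V, 0 ≤ f S
  mono : Monotone f
  submodular : IsSubmodular f
  curvature : totalCurvature f ≤ κ

theorem nonempty_feasible {V : Type} (P : Finset V) (k : ℕ) :
    (P.powerset.filter (fun S => S.card ≤ k)).Nonempty :=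
  ⟨∅, by simp⟩

/-- `max {f(S) : S ⊆ P, |S| ≤ k}`. -/
noncomputable def optWithin (f : Finset V → ℝ) (P : Finset V) (k : ℕ) : ℝ :=
  (P.powerset.filter (fun S => S.card ≤ k)).sup' (nonempty_feasible P k) f

/-- `OPT_k = max {f(S) : |S| ≤ k}`. -/
noncomputable def opt (f : Finset V → ℝ) (k : ℕ) : ℝ :=
  optWithin f Finset.univ k

end SetFunctions

/-- A deterministic, adaptive pruning algorithm in the value-oracle model, as a decision tree:
it either outputs a set, or asks for the value of a set and continues depending on the answer. -/
inductive QueryAlg (V : Type) : Type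
  | output (P : Finset V) : QueryAlg V
  | query (S : Finset V) (next : ℝ → QueryAlg V) : QueryAlg V

/-- The set output on the oracle `f`. -/
def QueryAlg.run {V : Type} (f : Finset V → ℝ) : QueryAlg V → Finset V
  | .output P => P
  | .query S next => (next (f S)).run f

/-- The number of value queries made on the oracle `f`. -/
def QueryAlg.numQueries {V : Type} (f : Finset V → ℝ) : QueryAlg V → ℕ
  | .output _ => 0
  | .query S next => (next (f S)).numQueries f + 1

/-- A randomized pruning algorithm: a random deterministic one, such that on each oracle the
output is a random variable. -/
structure RandAlg (V : Type) where
  Ω : Type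
  [measurableSpace : MeasurableSpace Ω]
  μ : Measure Ω
  [isProb : IsProbabilityMeasure μ]
  alg : Ω → QueryAlg V
  measurable_run : ∀ (f : Finset V → ℝ) (P : Finset V), MeasurableSet {ω | (alg ω).run f = P}

attribute [instance] RandAlg.measurableSpace RandAlg.isProb

section Pruning

variable {V : Type} [Fintype V] [DecidableEq V]

/-- On every non-negative monotone submodular function of total curvature at most `κ`, whatever the
coin flips, the algorithm makes at most `q` value queries and outputs at most `p` elements. -/
def RandAlg.IsPruner (A : RandAlg V) (κ : ℝ) (q p : ℕ) : Prop :=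
  ∀ f : Finset V → ℝ, IsBoundedCurvature κ f →
    ∀ ω : A.Ω, (A.alg ω).numQueries f ≤ q ∧ ((A.alg ω).run f).card ≤ p

/-- `𝔼[max {f(S) : S ⊆ P, |S| ≤ k}]`, where `P` is the random output on the oracle `f`. -/
noncomputable def RandAlg.expectedContainedValue (A : RandAlg V) (f : Finset V → ℝ) (k : ℕ) : ℝ :=
  ∫ ω, optWithin f ((A.alg ω).run f) k ∂A.μ

end Pruning

/-!
**Hardness.** The hard functions hide a `k`-set `O`. They are `κ F + (1 - κ) |S| / k`, where `F`
depends only on `a = |S ∩ O|` and `b = |S \ O|` (`profile`). Off the hidden set, `F` grows like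
`1 - (1 - 1 / k) ^ b` up to `b = k`, which leaves `1 / e` missing, and then linearly to `1`, reached
at `b = 2 k`. The first `t ≈ ε k / 2` hidden elements count like all others, the later ones add
linearly, so that `F O ≥ 1 - t / k`. The linear summand brings the curvature down to `κ` and the
missing value down to `κ / e`. A query distinguishes `O` from `∅` only if it has fewer than `3 k`
elements and more than `t` of them are hidden (`hiddenFun_eq`). With `n ≥ 60 k / ε` a random `O`
meets such a set in at most `3 k² / n ≤ ε k / 20` elements on average, and in more than `t` with probability
so small that even polynomially many (in `n`) queries all fail, however large `n` is
(`eventually_eval_mul_choose_le`). The output then does not depend on `O` and contains `p k / n`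
hidden elements on average, which raises its value by at most `ε / 60`. Averaging over `O` and over
the coin flips (`RandAlg.exists_hiddenFun_le`) gives one bad `O` for each algorithm.

**Tightness.** Write `f = g + ℓ`, where the linear `ℓ` has weights `f(v ∣ V \ {v})` (`topMarginal`)
and `g` (`curvedPart`) is again monotone submodular. Curvature at most `κ` means `g O ≤ κ f O`, so
it suffices to find `S` with `g S + ℓ S ≥ (1 - 1 / e) g O + ℓ O` up to a small error. A deterministic
non-oblivious local search does this: the solution is split into `T` classes, and the potential
(`potential`) adds up `g` over all unions of classes, with coefficients (`levelCoeff`) for which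
the inequalities of local optimality telescope to the factor `1 - (1 + 1 / T) ^ (-T)` on `g`
(`sum_levelCoeff`), while `ℓ` enters without loss (`le_of_swap_gain_le`). A round of the search that
starts below the target raises the potential by at least a fixed multiple of `OPT / k`, and the
potential is at most a constant times `OPT`, so linearly many rounds reach the target
(`localSearch_approx`).

**Curvature zero.** All marginal gains of an element equal its singleton value, so `f` is modular,
and the elements of largest singleton values are optimal for every cardinality bound.
-/

/-! ### Monotone submodular functions -/

section Submodular

variable {V : Type} [DecidableEq V] {f : Finset V → ℝ}

theorem marginalGain_anti (hm : Monotone f) (hs : IsSubmodular f) {A B : Finset V} (h : A ⊆ B)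
    (x : V) : marginalGain f x B ≤ marginalGain f x A := by
  by_cases hx : x ∈ B
  · have h1 : f A ≤ f (insert x A) := hm (Finset.subset_insert x A)
    simp only [marginalGain, Finset.insert_eq_of_mem hx, sub_self]
    linarith
  · exact hs A B h x hx

theorem sub_le_sum_marginalGain (hm : Monotone f) (hs : IsSubmodular f) (A O : Finset V) :
    f (A ∪ O) - f A ≤ ∑ o ∈ O, marginalGain f o A := by
  induction O using Finset.induction_on with
  | empty => simp
  | insert o O ho ih =>
    have h := marginalGain_anti hm hs (Finset.subset_union_left (s₁ := A) (s₂ := O)) o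
    rw [Finset.sum_insert ho, Finset.union_insert]
    simp only [marginalGain] at h ih ⊢
    linarith

/-- The losses from removing single elements of `D` from `A` add up to at most the loss from removing
all of `D`. -/
theorem sum_sub_erase_le (hm : Monotone f) (hs : IsSubmodular f) (A D : Finset V) :
    ∑ e ∈ D, (f A - f (A.erase e)) ≤ f A - f (A \ D) := by
  induction D using Finset.induction_on with
  | empty => simp
  | insert e D he ih =>
    rw [Finset.sum_insert he]
    have h : f (A \ D) - f (A \ insert e D) ≥ f A - f (A.erase e) := by
      by_cases hA : e ∈ A
      · have h := marginalGain_anti hm hs (A := A \ insert e D) (B := A.erase e) (by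
          intro x; simp only [Finset.mem_sdiff, Finset.mem_insert, Finset.mem_erase]; tauto) e
        have h2 : insert e (A \ insert e D) = A \ D := by
          ext x; simp only [Finset.mem_sdiff, Finset.mem_insert]
          by_cases hx : x = e
          · subst hx; tauto
          · tauto
        simpa only [marginalGain, Finset.insert_erase hA, h2] using h
      · have h2 : A \ insert e D = A \ D := by
          ext x; simp only [Finset.mem_sdiff, Finset.mem_insert]
          constructor
          · tauto
          · rintro ⟨h3, h4⟩
            exact ⟨h3, fun h5 => h5.elim (fun h6 => hA (h6 ▸ h3)) h4⟩
        rw [h2, Finset.erase_eq_of_notMem hA]; simp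
    linarith

/-- Subadditivity. Since `f ∅` may be positive, it fails for the empty set. -/
theorem le_sum_singleton (hm : Monotone f) (hs : IsSubmodular f) (h0 : 0 ≤ f ∅) {S : Finset V}
    (hS : S.Nonempty) : f S ≤ ∑ j ∈ S, f {j} := by
  have h := sub_le_sum_marginalGain hm hs ∅ S
  simp only [marginalGain, Finset.empty_union, insert_empty_eq, Finset.sum_sub_distrib,
    Finset.sum_const, nsmul_eq_mul] at h
  have h1 : (1 : ℝ) ≤ S.card := by exact_mod_cast hS.card_pos
  nlinarith

end Submodular

section OptWithin

variable {V : Type} {f : Finset V → ℝ}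

theorem le_optWithin {P S : Finset V} {k : ℕ} (hS : S ⊆ P) (hk : S.card ≤ k) :
    f S ≤ optWithin f P k :=
  Finset.le_sup' f (by simp [hS, hk])

theorem optWithin_le {P : Finset V} {k : ℕ} {b : ℝ} (h : ∀ S ⊆ P, S.card ≤ k → f S ≤ b) :
    optWithin f P k ≤ b :=
  Finset.sup'_le _ _ fun S hS => by
    simp only [Finset.mem_filter, Finset.mem_powerset] at hS
    exact h S hS.1 hS.2

theorem exists_eq_optWithin (f : Finset V → ℝ) (P : Finset V) (k : ℕ) :
    ∃ S ⊆ P, S.card ≤ k ∧ optWithin f P k = f S := by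
  obtain ⟨S, hS, h⟩ := Finset.exists_mem_eq_sup' (nonempty_feasible P k) f
  simp only [Finset.mem_filter, Finset.mem_powerset] at hS
  exact ⟨S, hS.1, hS.2, h⟩

theorem optWithin_le_opt [Fintype V] (f : Finset V → ℝ) (P : Finset V) (k : ℕ) :
    optWithin f P k ≤ opt f k :=
  optWithin_le fun _ _ h => le_optWithin (Finset.subset_univ _) h

end OptWithin

theorem monotone_of_le_insert {V : Type} [DecidableEq V] {f : Finset V → ℝ}
    (h : ∀ x A, x ∉ A → f A ≤ f (insert x A)) : Monotone f := by
  intro A B hAB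
  rw [← Finset.union_sdiff_of_subset hAB]
  generalize B \ A = D
  induction D using Finset.induction_on with
  | empty => simp
  | insert x D _ ih =>
    rw [Finset.union_insert]
    by_cases hx : x ∈ A ∪ D
    · rwa [Finset.insert_eq_of_mem hx]
    · exact ih.trans (h x _ hx)

section Curvature

variable {V : Type} [Fintype V] [DecidableEq V] {f : Finset V → ℝ} {κ : ℝ}

theorem IsBoundedCurvature.le_marginalGain (h : IsBoundedCurvature κ f) (j : V) :
    (1 - κ) * f {j} ≤ marginalGain f j (Finset.univ.erase j) := by
  have hpos : 0 ≤ marginalGain f j (Finset.univ.erase j) :=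
    sub_nonneg.2 (h.mono (Finset.subset_insert _ _))
  by_cases hj : f {j} = 0
  · rwa [hj, mul_zero]
  have hj' : 0 < f {j} := lt_of_le_of_ne (h.nonneg _) (Ne.symm hj)
  have hmem : j ∈ curvatureSupport f := by simp [curvatureSupport, hj]
  have hc := h.curvature
  rw [totalCurvature, dif_pos ⟨j, hmem⟩] at hc
  have h1 := (curvatureSupport f).inf'_le
    (fun j : V => marginalGain f j (Finset.univ.erase j) / f {j}) hmem
  have h2 : 1 - κ ≤ marginalGain f j (Finset.univ.erase j) / f {j} := by
    convert (sub_le_comm.1 hc).trans h1 using 1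
  rwa [le_div_iff₀ hj'] at h2

theorem totalCurvature_le (hκ : 0 ≤ κ) (hn : ∀ S : Finset V, 0 ≤ f S)
    (h : ∀ j, (1 - κ) * f {j} ≤ marginalGain f j (Finset.univ.erase j)) :
    totalCurvature f ≤ κ := by
  rw [totalCurvature]
  split_ifs with hne
  · rw [sub_le_comm]
    refine Finset.le_inf' _ _ fun j hj => ?_
    have hj' : f {j} ≠ 0 := by simpa [curvatureSupport] using hj
    rw [le_div_iff₀ (lt_of_le_of_ne (hn _) (Ne.symm hj'))]
    exact h j
  · exact hκ

end Curvature

/-! ### Batches of queries -/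

/-- Query all sets of a list; continue with a function that agrees with the oracle on the list
(and vanishes elsewhere). -/
noncomputable def QueryAlg.queryAll {V : Type} [DecidableEq V] :
    List (Finset V) → ((Finset V → ℝ) → QueryAlg V) → QueryAlg V
  | [], c => c (fun _ => 0)
  | S :: L, c => .query S fun r => queryAll L fun g => c (Function.update g S r)

theorem QueryAlg.exists_run_queryAll {V : Type} [DecidableEq V] (f : Finset V → ℝ)
    (L : List (Finset V)) (c : (Finset V → ℝ) → QueryAlg V) :
    ∃ g : Finset V → ℝ, (∀ S ∈ L, g S = f S) ∧ (queryAll L c).run f = (c g).run f ∧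
      (queryAll L c).numQueries f = L.length + (c g).numQueries f := by
  induction L generalizing c with
  | nil => exact ⟨fun _ => 0, by simp, rfl, by simp [queryAll]⟩
  | cons S L ih =>
    obtain ⟨g, h1, h2, h3⟩ := ih fun g => c (Function.update g S (f S))
    refine ⟨Function.update g S (f S), fun A hA => ?_, h2, ?_⟩
    · by_cases hAS : A = S
      · rw [hAS, Function.update_self]
      · rw [Function.update_of_ne hAS]
        exact h1 A ((List.mem_cons.1 hA).resolve_left hAS)
    · rw [queryAll, QueryAlg.numQueries, h3, List.length_cons]; omega

/-! ### Curvature zero -/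

section Heaviest

variable {V : Type} [DecidableEq V]

/-- A set of `m` elements of largest weights. -/
theorem exists_heaviest [Fintype V] (w : V → ℝ) {m : ℕ} (hm : m ≤ Fintype.card V) :
    ∃ P : Finset V, P.card = m ∧ ∀ x ∈ P, ∀ y ∉ P, w y ≤ w x := by
  have hne : (Finset.univ.powersetCard m : Finset (Finset V)).Nonempty :=
    Finset.powersetCard_nonempty.2 (by simpa using hm)
  obtain ⟨P, hP, hmax⟩ := Finset.exists_max_image _ (fun P : Finset V => ∑ x ∈ P, w x) hne
  have hPc : P.card = m := (Finset.mem_powersetCard.1 hP).2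
  refine ⟨P, hPc, fun x hx y hy => ?_⟩
  have hy' : y ∉ P.erase x := fun h => hy (Finset.mem_of_mem_erase h)
  have h := hmax (insert y (P.erase x)) (by
    simp only [Finset.mem_powersetCard, Finset.subset_univ, true_and]
    rw [Finset.card_insert_of_notMem hy', Finset.card_erase_of_mem hx, ← hPc]
    have := Finset.card_pos.2 ⟨x, hx⟩
    omega)
  rw [Finset.sum_insert hy', ← Finset.add_sum_erase _ _ hx] at h
  linarith

/-- Every set no larger than a heaviest set `P` is outweighed by a subset of `P` of the same
size. -/
theorem exists_subset_heaviest (w : V → ℝ) {P : Finset V} (hP : ∀ x ∈ P, ∀ y ∉ P, w y ≤ w x)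
    {S : Finset V} (hS : S.card ≤ P.card) :
    ∃ S' ⊆ P, S'.card = S.card ∧ ∑ x ∈ S, w x ≤ ∑ x ∈ S', w x := by
  have h1 := Finset.card_sdiff_add_card_inter S P
  have h2 := Finset.card_sdiff_add_card_inter P S
  rw [Finset.inter_comm P S] at h2
  obtain ⟨T, hT, hTc⟩ := Finset.exists_subset_card_eq (s := P \ S) (n := (S \ P).card) (by omega)
  have hdisj : Disjoint T (S ∩ P) := Finset.disjoint_left.2 fun x hx hx' =>
    (Finset.mem_sdiff.1 (hT hx)).2 (Finset.mem_inter.1 hx').1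
  refine ⟨T ∪ (S ∩ P), Finset.union_subset (hT.trans Finset.sdiff_subset)
    Finset.inter_subset_right, by rw [Finset.card_union_of_disjoint hdisj]; omega, ?_⟩
  have h3 : ∑ x ∈ S, w x = ∑ x ∈ S \ P, w x + ∑ x ∈ S ∩ P, w x := by
    rw [add_comm, Finset.sum_inter_add_sum_sdiff]
  rw [Finset.sum_union hdisj, h3]
  refine add_le_add ?_ le_rfl
  let e := Finset.equivOfCardEq hTc
  rw [← Finset.sum_coe_sort (S \ P), ← Finset.sum_coe_sort T, ← e.sum_comp]
  exact Finset.sum_le_sum fun x _ => hP _ (Finset.mem_sdiff.1 (hT x.2)).1 _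
    (Finset.mem_sdiff.1 (e x).2).2

end Heaviest

section CurvatureZero

variable {V : Type} [Fintype V] [DecidableEq V] {f : Finset V → ℝ}

theorem IsBoundedCurvature.eq_sum_of_zero (h : IsBoundedCurvature 0 f) (S : Finset V) :
    f S = f ∅ + ∑ j ∈ S, f {j} := by
  have key : ∀ j A, j ∉ A → marginalGain f j A = f {j} := by
    intro j A hj
    have h1 := h.le_marginalGain j
    have h2 := h.submodular A (Finset.univ.erase j)
      (fun x hx => by simpa using fun hxj : x = j => hj (hxj ▸ hx)) j (by simp)
    have h3 := h.submodular ∅ A (Finset.empty_subset _) j hj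
    have h4 : marginalGain f j ∅ = f {j} - f ∅ := by simp [marginalGain]
    have := h.nonneg ∅
    linarith
  induction S using Finset.induction_on with
  | empty => simp
  | insert j A hj ih =>
    have := key j A hj
    rw [Finset.sum_insert hj]
    simp only [marginalGain] at this
    linarith

theorem IsBoundedCurvature.isModular (h : IsBoundedCurvature 0 f) : IsModular f := by
  intro A B
  rw [h.eq_sum_of_zero (A ∪ B), h.eq_sum_of_zero (A ∩ B), h.eq_sum_of_zero A, h.eq_sum_of_zero B]
  have := Finset.sum_union_inter (s₁ := A) (s₂ := B) (f := fun j => f {j})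
  linarith

theorem exists_exact_pruning (n k p : ℕ) (hkp : k ≤ p) : ∃ A : QueryAlg (Fin n),
    ∀ f : Finset (Fin n) → ℝ, IsBoundedCurvature 0 f →
      IsModular f ∧ A.numQueries f ≤ n ∧ (A.run f).card ≤ p ∧
        ∀ k' : ℕ, k' ≤ k → optWithin f (A.run f) k' = opt f k' := by
  have hex : ∀ w : Fin n → ℝ, ∃ P : Finset (Fin n), P.card = min k n ∧
      ∀ x ∈ P, ∀ y ∉ P, w y ≤ w x := fun w => exists_heaviest w (by simp)
  choose top htop_card htop using hex
  let L : List (Finset (Fin n)) := (List.finRange n).map fun j => {j}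
  refine ⟨.queryAll L fun g => .output (top fun j => g {j}), fun f hf => ?_⟩
  obtain ⟨g, hg, hrun, hq⟩ := QueryAlg.exists_run_queryAll f L
    fun g => .output (top fun j => g {j})
  have hgw : (fun j => g {j}) = fun j => f {j} := funext fun j => hg _ (by simp [L])
  rw [hrun, hq, hgw]
  simp only [QueryAlg.run, QueryAlg.numQueries]
  refine ⟨hf.isModular, by simp [L], by rw [htop_card]; omega, fun k' hk' => ?_⟩
  refine le_antisymm (optWithin_le_opt _ _ _) (optWithin_le fun S _ hS => ?_)
  have hSn : S.card ≤ n := by simpa using S.card_le_univ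
  obtain ⟨S', h1, h2, h3⟩ := exists_subset_heaviest _ (htop fun j => f {j}) (S := S)
    (by rw [htop_card]; omega)
  refine le_trans ?_ (le_optWithin h1 (h2 ▸ hS))
  rw [hf.eq_sum_of_zero S, hf.eq_sum_of_zero S']
  linarith

end CurvatureZero

/-! ### Non-oblivious local search -/

/-- A bijection between sets of equal size that fixes their intersection. -/
theorem exists_equiv_fixing_inter {V : Type} [DecidableEq V] {S O : Finset V}
    (h : O.card = S.card) :
    ∃ σ : S ≃ O, ∀ e : S, (σ e : V) = e ∨ (σ e : V) ∉ S := by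
  obtain ⟨σ, hσ⟩ := Finset.exists_equiv_extend_of_card_eq (α := S) (t := O) (by simp [h])
    (s := Finset.univ.filter fun e : S => (e : V) ∈ O) (f := fun e => (e : V))
    (by intro v; simpa using fun h _ => h) (fun x _ y _ hxy => Subtype.ext hxy)
  refine ⟨σ, fun e => ?_⟩
  by_contra! hcon
  have h1 : (σ ⟨σ e, hcon.2⟩ : V) = σ e := hσ ⟨σ e, hcon.2⟩ (by simp)
  exact hcon.1 (congrArg Subtype.val (σ.injective (Subtype.ext h1)))

section LocalSearch

/-- The weight of an `m`-element set of classes in the potential: the solution to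
`(T - m) a (m + 1) = m (1 + 1 / T) a m` with `a 1 = 1 / T`. At `m = 0` it is `0`, by division by
zero. -/
noncomputable def levelCoeff (T m : ℕ) : ℝ :=
  (1 + 1 / (T : ℝ)) ^ (m - 1) / (m * T.choose m)

theorem levelCoeff_nonneg (T m : ℕ) : 0 ≤ levelCoeff T m := by
  unfold levelCoeff; positivity

theorem mul_levelCoeff {T m : ℕ} (h0 : m ≠ 0) :
    m * levelCoeff T m = (1 + 1 / (T : ℝ)) ^ (m - 1) / T.choose m := by
  have : (m : ℝ) ≠ 0 := by exact_mod_cast h0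
  unfold levelCoeff
  rw [← mul_div_assoc, mul_div_mul_left _ _ this]

theorem sub_mul_levelCoeff_succ {T m : ℕ} (h : m < T) :
    ((T : ℝ) - m) * levelCoeff T (m + 1) = (1 + 1 / (T : ℝ)) ^ m / T.choose m := by
  have hc := Nat.choose_succ_right_eq T m
  have hc' : (T.choose (m + 1) : ℝ) * (m + 1) = T.choose m * ((T : ℝ) - m) := by
    rw [← Nat.cast_sub h.le]; exact_mod_cast hc
  have h1 : ((T : ℝ) - m) ≠ 0 := by
    have : (m : ℝ) < T := by exact_mod_cast h
    linarith
  unfold levelCoeff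
  rw [Nat.add_sub_cancel, Nat.cast_succ, mul_comm (_ + 1 : ℝ), hc', mul_comm (T.choose m : ℝ),
    ← mul_div_assoc, mul_div_mul_left _ _ h1]

/-- The coefficient of `u K` in `sum_levelCoeff`. -/
theorem levelCoeff_telescope {T : ℕ} (hT : 0 < T) (K : Finset (Fin T)) :
    K.card * levelCoeff T K.card * (1 + 1 / (T : ℝ)) -
        ((T : ℝ) - K.card) * levelCoeff T (K.card + 1) =
      (if K = Finset.univ then (1 + 1 / (T : ℝ)) ^ T else 0) - if K = ∅ then 1 else 0 := by
  have hne : (Finset.univ : Finset (Fin T)) ≠ ∅ := by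
    have : Nonempty (Fin T) := ⟨⟨0, hT⟩⟩
    exact Finset.univ_nonempty.ne_empty
  by_cases h1 : K = ∅
  · subst h1
    rw [if_neg hne.symm, if_pos rfl, Finset.card_empty, sub_mul_levelCoeff_succ hT]
    simp
  have hK : K.card ≠ 0 := by simpa using h1
  have hpow : (1 + 1 / (T : ℝ)) ^ (K.card - 1) * (1 + 1 / (T : ℝ)) =
      (1 + 1 / (T : ℝ)) ^ K.card := by
    rw [← pow_succ, Nat.sub_add_cancel (Nat.pos_of_ne_zero hK)]
  rw [if_neg h1, mul_levelCoeff hK, div_mul_eq_mul_div, hpow]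
  by_cases h2 : K = Finset.univ
  · subst h2
    simp
  · have hlt : K.card < T := by
      have := (Finset.card_lt_iff_ne_univ K).2 h2
      simpa using this
    rw [if_neg h2, sub_mul_levelCoeff_succ hlt]
    simp

theorem sum_mul_sum_erase {T : ℕ} (a : ℕ → ℝ) (u : Finset (Fin T) → ℝ) :
    ∑ J : Finset (Fin T), a J.card * ∑ j ∈ J, u (J.erase j) =
      ∑ K : Finset (Fin T), ((T : ℝ) - K.card) * a (K.card + 1) * u K := by
  have h1 : ∀ K : Finset (Fin T), ((T : ℝ) - K.card) * a (K.card + 1) * u K =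
      ∑ j ∈ Kᶜ, a (K.card + 1) * u K := fun K => by
    rw [Finset.sum_const, Finset.card_compl, Fintype.card_fin, nsmul_eq_mul,
      Nat.cast_sub (by simpa using K.card_le_univ), mul_assoc]
  simp_rw [h1, Finset.mul_sum]
  rw [Finset.sum_sigma', Finset.sum_sigma']
  refine Finset.sum_bij' (fun x _ => ⟨x.1.erase x.2, x.2⟩) (fun x _ => ⟨insert x.2 x.1, x.2⟩)
    ?_ ?_ ?_ ?_ ?_
  · rintro ⟨J, j⟩ h; simp
  · rintro ⟨J, j⟩ h; simp
  · rintro ⟨J, j⟩ h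
    simp only [Finset.mem_sigma, Finset.mem_univ, true_and] at h
    simp [Finset.insert_erase h]
  · rintro ⟨J, j⟩ h
    simp only [Finset.mem_sigma, Finset.mem_univ, true_and, Finset.mem_compl] at h
    simp [Finset.erase_insert h]
  · rintro ⟨J, j⟩ h
    simp only [Finset.mem_sigma, Finset.mem_univ, true_and] at h
    simp only
    rw [Finset.card_erase_of_mem h, Nat.sub_add_cancel (Finset.card_pos.2 ⟨j, h⟩)]

/-- The identity behind the choice of the coefficients: all values of `u` cancel except those at
the two extreme sets. -/
theorem sum_levelCoeff {T : ℕ} (hT : 0 < T) (u : Finset (Fin T) → ℝ) :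
    ∑ J : Finset (Fin T), levelCoeff T J.card *
        (∑ j ∈ J, (u J - u (J.erase j)) + J.card / T * u J) =
      (1 + 1 / (T : ℝ)) ^ T * u Finset.univ - u ∅ := by
  have h1 : ∑ J : Finset (Fin T), levelCoeff T J.card *
        (∑ j ∈ J, (u J - u (J.erase j)) + J.card / T * u J) =
      ∑ K : Finset (Fin T), (K.card * levelCoeff T K.card * (1 + 1 / (T : ℝ)) -
        ((T : ℝ) - K.card) * levelCoeff T (K.card + 1)) * u K := by
    simp_rw [sub_mul _ _ (u _), Finset.sum_sub_distrib, mul_add, mul_sub, Finset.sum_add_distrib,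
      Finset.sum_sub_distrib, sum_mul_sum_erase, Finset.sum_const, nsmul_eq_mul]
    rw [sub_add_eq_add_sub, ← Finset.sum_add_distrib]
    congr 1
    exact Finset.sum_congr rfl fun J _ => by ring
  rw [h1]
  simp_rw [levelCoeff_telescope hT, sub_mul, Finset.sum_sub_distrib, ite_mul, zero_mul, one_mul]
  simp

variable {V : Type} [Fintype V] {T : ℕ}

/-- A solution split into `T` classes is encoded as `χ : V → Option (Fin T)`, with value `none`
outside the solution. `classUnion χ J` is the union of the classes with index in `J`. -/
def classUnion (χ : V → Option (Fin T)) (J : Finset (Fin T)) : Finset V :=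
  Finset.univ.filter fun v => ∃ j ∈ J, χ v = some j

/-- The whole solution encoded by `χ`. -/
def solution (χ : V → Option (Fin T)) : Finset V := classUnion χ Finset.univ

theorem mem_classUnion {χ : V → Option (Fin T)} {J : Finset (Fin T)} {v : V} :
    v ∈ classUnion χ J ↔ ∃ j ∈ J, χ v = some j := by simp [classUnion]

theorem mem_solution {χ : V → Option (Fin T)} {v : V} : v ∈ solution χ ↔ χ v ≠ none := by
  rw [solution, mem_classUnion, Option.ne_none_iff_exists']
  simp

theorem classUnion_subset_solution (χ : V → Option (Fin T)) (J : Finset (Fin T)) :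
    classUnion χ J ⊆ solution χ := fun v hv => by
  obtain ⟨j, -, h⟩ := mem_classUnion.1 hv
  simp [mem_solution, h]

variable [DecidableEq V]

/-- Remove `e` from the solution and put `o` into class `j`. For `o = e` this moves `e` to class
`j`. -/
def swap (χ : V → Option (Fin T)) (e o : V) (j : Fin T) : V → Option (Fin T) :=
  Function.update (Function.update χ e none) o (some j)

/-- The potential guiding the local search for maximizing `g + ∑ w`. -/
noncomputable def potential (g : Finset V → ℝ) (w : V → ℝ) (χ : V → Option (Fin T)) : ℝ :=
  ∑ J : Finset (Fin T), levelCoeff T J.card * g (classUnion χ J) +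
    (1 + 1 / (T : ℝ)) ^ T * ∑ v ∈ solution χ, w v

theorem classUnion_swap {χ : V → Option (Fin T)} {e o : V} (ho : o = e ∨ o ∉ solution χ)
    (j : Fin T) (J : Finset (Fin T)) :
    classUnion (swap χ e o j) J =
      if j ∈ J then insert o ((classUnion χ J).erase e) else (classUnion χ J).erase e := by
  ext v
  have key : v ∈ classUnion (swap χ e o j) J ↔
      if v = o then j ∈ J else v ∈ (classUnion χ J).erase e := by
    rw [mem_classUnion, swap]
    by_cases hv : v = o
    · subst hv
      simp
    · rw [Function.update_of_ne hv, if_neg hv, Finset.mem_erase, mem_classUnion]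
      by_cases hve : v = e
      · subst hve
        simp
      · simp [hve]
  rw [key]
  have hoJ : o ∉ (classUnion χ J).erase e := by
    rcases ho with rfl | ho
    · simp
    · exact fun h => ho (classUnion_subset_solution χ J (Finset.mem_of_mem_erase h))
  by_cases hv : v = o
  · subst hv
    by_cases hj : j ∈ J <;> simp [hj, hoJ]
  · by_cases hj : j ∈ J <;> simp [hj, hv]

theorem solution_swap {χ : V → Option (Fin T)} {e o : V} (ho : o = e ∨ o ∉ solution χ)
    (j : Fin T) : solution (swap χ e o j) = insert o ((solution χ).erase e) := by
  rw [solution, classUnion_swap ho, if_pos (Finset.mem_univ j)]; rfl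

theorem notMem_erase_solution {χ : V → Option (Fin T)} {e o : V} (ho : o = e ∨ o ∉ solution χ) :
    o ∉ (solution χ).erase e := by
  rcases ho with rfl | ho
  · simp
  · exact fun h => ho (Finset.mem_of_mem_erase h)

theorem card_solution_swap {χ : V → Option (Fin T)} {e o : V} (he : e ∈ solution χ)
    (ho : o = e ∨ o ∉ solution χ) (j : Fin T) :
    (solution (swap χ e o j)).card = (solution χ).card := by
  rw [solution_swap ho, Finset.card_insert_of_notMem (notMem_erase_solution ho),
    Finset.card_erase_add_one he]

/-- By submodularity, a swap gains at least what adding `o` to the old classes would gain, less the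
cost of removing `e`. -/
theorem potential_swap_ge {g : Finset V → ℝ} (hm : Monotone g) (hs : IsSubmodular g) (w : V → ℝ)
    {χ : V → Option (Fin T)} {e o : V} (he : e ∈ solution χ) (ho : o = e ∨ o ∉ solution χ)
    (j : Fin T) :
    (1 + 1 / (T : ℝ)) ^ T * (w o - w e) + ∑ J : Finset (Fin T), levelCoeff T J.card *
        ((if j ∈ J then marginalGain g o (classUnion χ J) else 0) -
          (g (classUnion χ J) - g ((classUnion χ J).erase e))) ≤
      potential g w (swap χ e o j) - potential g w χ := by
  have h1 : ∑ v ∈ solution (swap χ e o j), w v = ∑ v ∈ solution χ, w v + (w o - w e) := by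
    rw [solution_swap ho, Finset.sum_insert (notMem_erase_solution ho),
      ← Finset.add_sum_erase _ _ he]
    ring
  have h2 : ∑ J : Finset (Fin T), levelCoeff T J.card *
        ((if j ∈ J then marginalGain g o (classUnion χ J) else 0) -
          (g (classUnion χ J) - g ((classUnion χ J).erase e))) ≤
      ∑ J : Finset (Fin T), levelCoeff T J.card *
        (g (classUnion (swap χ e o j) J) - g (classUnion χ J)) := by
    refine Finset.sum_le_sum fun J _ => mul_le_mul_of_nonneg_left ?_ (levelCoeff_nonneg _ _)
    rw [classUnion_swap ho]
    have := marginalGain_anti hm hs (Finset.erase_subset e (classUnion χ J)) o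
    split_ifs
    · simp only [marginalGain] at this ⊢
      linarith
    · linarith
  simp_rw [mul_sub _ (g (classUnion (swap _ _ _ _) _)), Finset.sum_sub_distrib] at h2
  rw [potential, potential, h1, mul_add]
  linarith

theorem sum_sub_erase_classUnion_le {g : Finset V → ℝ} (hm : Monotone g) (hs : IsSubmodular g)
    (χ : V → Option (Fin T)) (J : Finset (Fin T)) :
    ∑ e ∈ solution χ, (g (classUnion χ J) - g ((classUnion χ J).erase e)) ≤
      ∑ j ∈ J, (g (classUnion χ J) - g (classUnion χ (J.erase j))) := by
  have h1 : classUnion χ J = J.biUnion fun j => classUnion χ {j} := by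
    ext v; simp [mem_classUnion]
  rw [← Finset.sum_subset (classUnion_subset_solution χ J) fun e _ he => by
    rw [Finset.erase_eq_of_notMem he, sub_self]]
  conv_lhs => rw [h1]
  rw [Finset.sum_biUnion, ← h1]
  · refine Finset.sum_le_sum fun j hj => (sum_sub_erase_le hm hs _ _).trans_eq ?_
    congr 2
    ext v
    simp only [Finset.mem_sdiff, mem_classUnion, Finset.mem_erase, Finset.mem_singleton]
    constructor
    · rintro ⟨⟨i, hi, hvi⟩, hv⟩
      exact ⟨i, ⟨fun hij => hv ⟨i, hij, hvi⟩, hi⟩, hvi⟩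
    · rintro ⟨i, ⟨hij, hi⟩, hvi⟩
      refine ⟨⟨i, hi, hvi⟩, ?_⟩
      rintro ⟨l, rfl, hvl⟩
      exact hij (Option.some_injective _ (hvi.symm.trans hvl))
  · intro i _ l _ hil
    refine Finset.disjoint_left.2 fun v hv hv' => hil ?_
    simp only [mem_classUnion, Finset.mem_singleton, exists_eq_left] at hv hv'
    exact Option.some_injective _ (hv.symm.trans hv')

/-- If no swap raises the potential by more than `G`, the solution is nearly as good as any other
solution `O` of the same size, up to the loss of a fraction `(1 + 1 / T) ^ (-T)` of `g O`. -/
theorem le_of_swap_gain_le (hT : 0 < T) {g : Finset V → ℝ} (hm : Monotone g) (hs : IsSubmodular g)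
    (h0 : 0 ≤ g ∅) (w : V → ℝ) {χ : V → Option (Fin T)} {O : Finset V}
    (hO : O.card = (solution χ).card) {G : ℝ}
    (hG : ∀ e ∈ solution χ, ∀ o, (o = e ∨ o ∉ solution χ) → ∀ j,
      potential g w (swap χ e o j) - potential g w χ ≤ G) :
    ((1 + 1 / (T : ℝ)) ^ T - 1) * g O + (1 + 1 / (T : ℝ)) ^ T * ∑ v ∈ O, w v -
      (1 + 1 / (T : ℝ)) ^ T * (g (solution χ) + ∑ v ∈ solution χ, w v) ≤ O.card * G := by
  set c : ℝ := (1 + 1 / (T : ℝ)) ^ T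
  set S := solution χ
  obtain ⟨σ, hσ⟩ := exists_equiv_fixing_inter hO
  have hT' : (0 : ℝ) < T := by exact_mod_cast hT
  have hsum : ∀ h : V → ℝ, ∑ e : S, h (σ e) = ∑ o ∈ O, h o := fun h => by
    rw [σ.sum_comp fun o : O => h o, Finset.sum_coe_sort]
  have hsumS : ∀ h : V → ℝ, ∑ e : S, h e = ∑ e ∈ S, h e := fun h => Finset.sum_coe_sort S h
  -- Sum the gains of the swaps `e ↦ (σ e, j)` over all `e` and `j`.
  have h1 : ∑ e : S, ∑ j : Fin T, (c * (w (σ e) - w e) + ∑ J : Finset (Fin T),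
      levelCoeff T J.card * ((if j ∈ J then marginalGain g (σ e) (classUnion χ J) else 0) -
          (g (classUnion χ J) - g ((classUnion χ J).erase e)))) ≤ T * (O.card * G) := by
    have : ∑ _e : S, ∑ _j : Fin T, G = T * (O.card * G) := by
      simp only [Finset.sum_const, Finset.card_univ, Fintype.card_fin, Fintype.card_coe,
        nsmul_eq_mul, hO]
      ring
    rw [← this]
    exact Finset.sum_le_sum fun e _ => Finset.sum_le_sum fun j _ =>
      (potential_swap_ge hm hs w e.2 (hσ e) j).trans (hG e e.2 _ (hσ e) j)
  have h2 : ∑ e : S, ∑ j : Fin T, (c * (w (σ e) - w e) + ∑ J : Finset (Fin T),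
      levelCoeff T J.card * ((if j ∈ J then marginalGain g (σ e) (classUnion χ J) else 0) -
          (g (classUnion χ J) - g ((classUnion χ J).erase e)))) =
      T * (c * (∑ v ∈ O, w v - ∑ v ∈ S, w v)) + ∑ J : Finset (Fin T), levelCoeff T J.card *
        (J.card * ∑ o ∈ O, marginalGain g o (classUnion χ J) -
          T * ∑ e ∈ S, (g (classUnion χ J) - g ((classUnion χ J).erase e))) := by
    simp_rw [Finset.sum_add_distrib, Finset.sum_const, Finset.card_univ, Fintype.card_fin,
      nsmul_eq_mul, ← Finset.mul_sum, Finset.sum_sub_distrib, hsum w, hsumS w]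
    congr 1
    have : ∀ e : S, ∑ j : Fin T, ∑ J : Finset (Fin T), levelCoeff T J.card *
        ((if j ∈ J then marginalGain g (σ e) (classUnion χ J) else 0) -
          (g (classUnion χ J) - g ((classUnion χ J).erase e))) =
        ∑ J : Finset (Fin T), levelCoeff T J.card * (J.card * marginalGain g (σ e) (classUnion χ J)
          - T * (g (classUnion χ J) - g ((classUnion χ J).erase e))) := fun e => by
      rw [Finset.sum_comm]
      refine Finset.sum_congr rfl fun J _ => ?_
      rw [← Finset.mul_sum, Finset.sum_sub_distrib]
      congr 2 <;> simp [mul_sub]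
    simp_rw [this]
    rw [Finset.sum_comm]
    refine Finset.sum_congr rfl fun J _ => ?_
    rw [← Finset.mul_sum, Finset.sum_sub_distrib, ← Finset.mul_sum, ← Finset.mul_sum,
      hsum fun o => marginalGain g o (classUnion χ J),
      hsumS fun e => g (classUnion χ J) - g ((classUnion χ J).erase e), Finset.sum_sub_distrib]
  have h3 : ∑ J : Finset (Fin T), levelCoeff T J.card *
      (J.card * (g O - g (classUnion χ J)) -
        T * ∑ j ∈ J, (g (classUnion χ J) - g (classUnion χ (J.erase j)))) ≤
      ∑ J : Finset (Fin T), levelCoeff T J.card *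
        (J.card * ∑ o ∈ O, marginalGain g o (classUnion χ J) -
          T * ∑ e ∈ S, (g (classUnion χ J) - g ((classUnion χ J).erase e))) := by
    refine Finset.sum_le_sum fun J _ => mul_le_mul_of_nonneg_left ?_ (levelCoeff_nonneg _ _)
    have h4 := sum_sub_erase_classUnion_le hm hs χ J
    have h5 := sub_le_sum_marginalGain hm hs (classUnion χ J) O
    have h6 : g O ≤ g (classUnion χ J ∪ O) := hm Finset.subset_union_right
    gcongr
    linarith
  have h7 := sum_levelCoeff hT fun J => g (classUnion χ J)
  have h8 := sum_levelCoeff hT fun _ => (1 : ℝ)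
  have h9 : ∑ J : Finset (Fin T), levelCoeff T J.card *
      (J.card * (g O - g (classUnion χ J)) -
        T * ∑ j ∈ J, (g (classUnion χ J) - g (classUnion χ (J.erase j)))) =
      T * (g O * ∑ J : Finset (Fin T), levelCoeff T J.card *
          (∑ j ∈ J, ((1 : ℝ) - 1) + J.card / T * 1) -
        ∑ J : Finset (Fin T), levelCoeff T J.card *
          (∑ j ∈ J, (g (classUnion χ J) - g (classUnion χ (J.erase j))) +
            J.card / T * g (classUnion χ J))) := by
    rw [Finset.mul_sum, ← Finset.sum_sub_distrib, Finset.mul_sum]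
    refine Finset.sum_congr rfl fun J _ => ?_
    rw [sub_self, Finset.sum_const_zero]
    field_simp
    ring
  rw [h7, h8] at h9
  have h10 : classUnion χ (∅ : Finset (Fin T)) = ∅ := by
    ext v; simp [mem_classUnion]
  rw [h10] at h9
  change _ = T * (g O * (c * 1 - 1) - (c * g S - g ∅)) at h9
  rw [h2] at h1
  have h11 : T * (c * (∑ v ∈ O, w v - ∑ v ∈ S, w v) + (g O * (c * 1 - 1) - (c * g S - g ∅))) ≤
      T * (O.card * G) := by linarith
  have h12 := le_of_mul_le_mul_left h11 hT'
  linarith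

end LocalSearch

/-! ### The local search as a query algorithm -/

theorem exists_card_eq_opt {V : Type} [Fintype V] {f : Finset V → ℝ} (hm : Monotone f)
    {k : ℕ} (hk : k ≤ Fintype.card V) :
    ∃ O : Finset V, O.card = k ∧ f O = opt f k := by
  obtain ⟨S, -, hS, h⟩ := exists_eq_optWithin f Finset.univ k
  obtain ⟨O, hSO, hO⟩ := Finset.exists_superset_card_eq hS hk
  exact ⟨O, hO, le_antisymm (le_optWithin (Finset.subset_univ _) hO.le) (h.le.trans (hm hSO))⟩

/-- A deterministic algorithm as a randomized one. -/
noncomputable def RandAlg.ofQueryAlg {V : Type} (A : QueryAlg V) : RandAlg V where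
  Ω := Unit
  μ := Measure.dirac ()
  alg := fun _ => A
  measurable_run := fun _ _ => MeasurableSet.of_discrete

theorem RandAlg.expectedContainedValue_ofQueryAlg {V : Type} (A : QueryAlg V)
    (f : Finset V → ℝ) (k : ℕ) :
    (RandAlg.ofQueryAlg A).expectedContainedValue f k = optWithin f (A.run f) k :=
  integral_dirac (fun _ : Unit => optWithin f (A.run f) k) ()

section Tightness

variable {V : Type} [Fintype V] [DecidableEq V] {T : ℕ} {f : Finset V → ℝ} {κ : ℝ}

/-- The marginal gain of `v` over all other elements: the part of `f` that is linear. -/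
def topMarginal (f : Finset V → ℝ) (v : V) : ℝ := f Finset.univ - f (Finset.univ.erase v)

/-- What is left of `f` after its linear part has been removed. -/
def curvedPart (f : Finset V → ℝ) (S : Finset V) : ℝ := f S - ∑ v ∈ S, topMarginal f v

theorem topMarginal_eq (f : Finset V → ℝ) (v : V) :
    topMarginal f v = marginalGain f v (Finset.univ.erase v) := by
  rw [topMarginal, marginalGain, Finset.insert_erase (Finset.mem_univ v)]

theorem topMarginal_nonneg (hm : Monotone f) (v : V) : 0 ≤ topMarginal f v :=
  sub_nonneg.2 (hm (Finset.subset_univ _))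

theorem marginalGain_curvedPart {A : Finset V} {x : V} (hx : x ∉ A) :
    marginalGain (curvedPart f) x A = marginalGain f x A - topMarginal f x := by
  simp only [marginalGain, curvedPart, Finset.sum_insert hx]
  ring

theorem monotone_curvedPart (hs : IsSubmodular f) : Monotone (curvedPart f) := by
  refine monotone_of_le_insert fun x A hx => ?_
  have h1 := marginalGain_curvedPart (f := f) hx
  have h2 := hs A (Finset.univ.erase x)
    (fun y hy => by simpa using fun h : y = x => hx (h ▸ hy)) x (by simp)
  rw [← topMarginal_eq] at h2
  rw [marginalGain] at h1
  linarith

theorem isSubmodular_curvedPart (hs : IsSubmodular f) : IsSubmodular (curvedPart f) := by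
  intro A B hAB x hx
  rw [marginalGain_curvedPart hx, marginalGain_curvedPart fun h => hx (hAB h)]
  linarith [hs A B hAB x hx]

theorem curvedPart_empty : curvedPart f ∅ = f ∅ := by simp [curvedPart]

theorem sum_topMarginal_le (h0 : 0 ≤ f ∅) (hs : IsSubmodular f) (S : Finset V) :
    ∑ v ∈ S, topMarginal f v ≤ f S := by
  have h1 := monotone_curvedPart hs (Finset.empty_subset S)
  rw [curvedPart_empty, curvedPart] at h1
  linarith

/-- Bounded curvature limits the part of `f` on which the local search loses. -/
theorem IsBoundedCurvature.curvedPart_le (h : IsBoundedCurvature κ f) (hκ : κ ≤ 1) {S : Finset V}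
    (hS : S.Nonempty) : curvedPart f S ≤ κ * f S := by
  have h1 : (1 - κ) * ∑ j ∈ S, f {j} ≤ ∑ v ∈ S, topMarginal f v := by
    rw [Finset.mul_sum]
    exact Finset.sum_le_sum fun j _ => (h.le_marginalGain j).trans_eq (topMarginal_eq f j).symm
  have h2 := mul_le_mul_of_nonneg_left (le_sum_singleton h.mono h.submodular (h.nonneg ∅) hS)
    (sub_nonneg.2 hκ)
  rw [curvedPart]
  linarith

/-- The potential of the local search for `f`, as a function of the values of `f`. -/
noncomputable def searchPotential (f : Finset V → ℝ) (χ : V → Option (Fin T)) : ℝ :=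
  potential (curvedPart f) (topMarginal f) χ

/-- The solutions reached from `χ` by a swap, and `χ` itself. -/
def neighbors (χ : V → Option (Fin T)) : Finset (V → Option (Fin T)) :=
  insert χ ((Finset.univ.filter fun x : V × V × Fin T =>
    x.1 ∈ solution χ ∧ (x.2.1 = x.1 ∨ x.2.1 ∉ solution χ)).image
      fun x => swap χ x.1 x.2.1 x.2.2)

theorem swap_mem_neighbors {χ : V → Option (Fin T)} {e o : V} (he : e ∈ solution χ)
    (ho : o = e ∨ o ∉ solution χ) (j : Fin T) : swap χ e o j ∈ neighbors χ :=
  Finset.mem_insert_of_mem (Finset.mem_image.2 ⟨(e, o, j), by simp [he, ho], rfl⟩)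

theorem card_solution_of_mem_neighbors {χ χ' : V → Option (Fin T)} (h : χ' ∈ neighbors χ) :
    (solution χ').card = (solution χ).card := by
  rcases Finset.mem_insert.1 h with rfl | h
  · rfl
  · obtain ⟨⟨e, o, j⟩, hx, rfl⟩ := Finset.mem_image.1 h
    simp only [Finset.mem_filter, Finset.mem_univ, true_and] at hx
    exact card_solution_swap hx.1 hx.2 j

theorem card_neighbors_le (χ : V → Option (Fin T)) :
    (neighbors χ).card ≤ Fintype.card V * (Fintype.card V * T) + 1 := by
  refine (Finset.card_insert_le _ _).trans (Nat.succ_le_succ ?_)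
  refine Finset.card_image_le.trans ((Finset.card_filter_le _ _).trans_eq ?_)
  simp

theorem exists_best_neighbor (g : Finset V → ℝ) (χ : V → Option (Fin T)) :
    ∃ χ' ∈ neighbors χ, ∀ χ'' ∈ neighbors χ, searchPotential g χ'' ≤ searchPotential g χ' :=
  Finset.exists_max_image _ _ ⟨χ, Finset.mem_insert_self _ _⟩

/-- A neighbor of largest potential. -/
noncomputable def bestNeighbor (g : Finset V → ℝ) (χ : V → Option (Fin T)) :
    V → Option (Fin T) :=
  (exists_best_neighbor g χ).choose

theorem bestNeighbor_mem (g : Finset V → ℝ) (χ : V → Option (Fin T)) :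
    bestNeighbor g χ ∈ neighbors χ :=
  (exists_best_neighbor g χ).choose_spec.1

theorem searchPotential_le_bestNeighbor (g : Finset V → ℝ) {χ χ' : V → Option (Fin T)}
    (h : χ' ∈ neighbors χ) : searchPotential g χ' ≤ searchPotential g (bestNeighbor g χ) :=
  (exists_best_neighbor g χ).choose_spec.2 χ' h

/-- The sets whose values determine the next round of the local search from the solution `χ`, if
`B` is the best set so far. -/
noncomputable def roundQueries (χ : V → Option (Fin T)) (B : Finset V) : List (Finset V) :=
  B :: solution χ :: Finset.univ ::
    ((Finset.univ.image fun v : V => Finset.univ.erase v).toList ++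
      ((neighbors χ ×ˢ Finset.univ).image fun x => classUnion x.1 x.2).toList)

theorem length_roundQueries_le (χ : V → Option (Fin T)) (B : Finset V) :
    (roundQueries χ B).length ≤
      Fintype.card V + (Fintype.card V * (Fintype.card V * T) + 1) * 2 ^ T + 3 := by
  have h1 : (Finset.univ.image fun v : V => Finset.univ.erase v).card ≤ Fintype.card V :=
    Finset.card_image_le
  have h2 : ((neighbors χ ×ˢ (Finset.univ : Finset (Finset (Fin T)))).image
      fun x => classUnion x.1 x.2).card ≤
      (Fintype.card V * (Fintype.card V * T) + 1) * 2 ^ T := by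
    refine Finset.card_image_le.trans ?_
    rw [Finset.card_product, Finset.card_univ, Fintype.card_finset, Fintype.card_fin]
    exact Nat.mul_le_mul_right _ (card_neighbors_le χ)
  simp only [roundQueries, List.length_cons, List.length_append, Finset.length_toList]
  omega

/-- The queries of a round determine the potential of all neighbors. -/
theorem searchPotential_congr {g : Finset V → ℝ} {χ χ' : V → Option (Fin T)} {B : Finset V}
    (hg : ∀ S ∈ roundQueries χ B, g S = f S) (h : χ' ∈ neighbors χ) :
    searchPotential g χ' = searchPotential f χ' := by
  have h1 : topMarginal g = topMarginal f := funext fun v => by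
    rw [topMarginal, topMarginal, hg _ (by simp [roundQueries]), hg _ (by simp [roundQueries])]
  have h2 : ∀ J, curvedPart g (classUnion χ' J) = curvedPart f (classUnion χ' J) := fun J => by
    rw [curvedPart, curvedPart, h1, hg]
    simp only [roundQueries, List.mem_cons, List.mem_append, Finset.mem_toList, Finset.mem_image,
      Finset.mem_product]
    exact Or.inr (Or.inr (Or.inr (Or.inr ⟨(χ', J), ⟨h, Finset.mem_univ _⟩, rfl⟩)))
  simp only [searchPotential, potential, h1, h2]

/-- `R` rounds of best-improvement local search from `χ`, remembering the best set `B`. -/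
noncomputable def localSearch : ℕ → (V → Option (Fin T)) → Finset V → QueryAlg V
  | 0, _, B => .output B
  | R + 1, χ, B => .queryAll (roundQueries χ B) fun g =>
      localSearch R (bestNeighbor g χ) (if g B ≤ g (solution χ) then solution χ else B)

theorem localSearch_bounds (f : Finset V → ℝ) {k : ℕ} (R : ℕ) (χ : V → Option (Fin T))
    (B : Finset V) (hχ : (solution χ).card = k) (hB : B.card = k) :
    ((localSearch R χ B).run f).card = k ∧ (localSearch R χ B).numQueries f ≤
      R * (Fintype.card V + (Fintype.card V * (Fintype.card V * T) + 1) * 2 ^ T + 3) := by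
  induction R generalizing χ B with
  | zero => simpa [localSearch, QueryAlg.run, QueryAlg.numQueries] using hB
  | succ R ih =>
    obtain ⟨g, -, h1, h2⟩ := QueryAlg.exists_run_queryAll f (roundQueries χ B) fun g =>
      localSearch R (bestNeighbor g χ) (if g B ≤ g (solution χ) then solution χ else B)
    rw [localSearch, h1, h2]
    obtain ⟨h3, h4⟩ := ih (bestNeighbor g χ) (if g B ≤ g (solution χ) then solution χ else B)
      (by rw [card_solution_of_mem_neighbors (bestNeighbor_mem g χ), hχ])
      (by split_ifs <;> assumption)
    refine ⟨h3, ?_⟩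
    have h5 := length_roundQueries_le χ B
    rw [Nat.succ_mul]
    omega

/-- If below the target value `τ` some neighbor always raises the potential by `γ`, then `R` rounds
either reach the target or raise the potential by `R * γ`. -/
theorem localSearch_progress {τ γ M : ℝ} {k : ℕ}
    (hM : ∀ χ : V → Option (Fin T), (solution χ).card = k → searchPotential f χ ≤ M)
    (hγ : ∀ χ : V → Option (Fin T), (solution χ).card = k → f (solution χ) < τ →
      ∃ χ' ∈ neighbors χ, searchPotential f χ + γ ≤ searchPotential f χ')
    (R : ℕ) (χ : V → Option (Fin T)) (B : Finset V) (hχ : (solution χ).card = k) :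
    f B ≤ f ((localSearch R χ B).run f) ∧
      (τ ≤ f ((localSearch R χ B).run f) ∨ searchPotential f χ + R * γ ≤ M) := by
  induction R generalizing χ B with
  | zero => exact ⟨le_rfl, Or.inr (by simpa using hM χ hχ)⟩
  | succ R ih =>
    obtain ⟨g, hg, h1, -⟩ := QueryAlg.exists_run_queryAll f (roundQueries χ B) fun g =>
      localSearch R (bestNeighbor g χ) (if g B ≤ g (solution χ) then solution χ else B)
    rw [localSearch, h1, hg B (by simp [roundQueries]), hg (solution χ) (by simp [roundQueries])]
    have hnext := bestNeighbor_mem g χ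
    obtain ⟨h2, h3⟩ := ih (bestNeighbor g χ) (if f B ≤ f (solution χ) then solution χ else B)
      (by rw [card_solution_of_mem_neighbors hnext, hχ])
    have hB : f B ≤ f (if f B ≤ f (solution χ) then solution χ else B) ∧
        f (solution χ) ≤ f (if f B ≤ f (solution χ) then solution χ else B) := by
      split_ifs with h
      · exact ⟨h, le_rfl⟩
      · exact ⟨le_rfl, (not_le.1 h).le⟩
    refine ⟨hB.1.trans h2, ?_⟩
    rcases h3 with h3 | h3
    · exact Or.inl h3
    by_cases hτ : τ ≤ f (solution χ)
    · exact Or.inl (hτ.trans (hB.2.trans h2))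
    obtain ⟨χ', hχ', h4⟩ := hγ χ hχ (not_le.1 hτ)
    have h5 := searchPotential_le_bestNeighbor g hχ'
    rw [searchPotential_congr hg hχ', searchPotential_congr hg hnext] at h5
    right
    push_cast
    linarith

theorem searchPotential_nonneg (hf : IsBoundedCurvature κ f) (χ : V → Option (Fin T)) :
    0 ≤ searchPotential f χ := by
  have h1 : ∀ S, 0 ≤ curvedPart f S := fun S => by
    have := monotone_curvedPart hf.submodular (Finset.empty_subset S)
    rw [curvedPart_empty] at this
    exact (hf.nonneg _).trans this
  refine add_nonneg (Finset.sum_nonneg fun J _ => mul_nonneg (levelCoeff_nonneg _ _) (h1 _))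
    (mul_nonneg (by positivity) (Finset.sum_nonneg fun v _ => topMarginal_nonneg hf.mono v))

theorem searchPotential_le (hf : IsBoundedCurvature κ f) {k : ℕ} {χ : V → Option (Fin T)}
    (hχ : (solution χ).card = k) :
    searchPotential f χ ≤ (∑ J : Finset (Fin T), levelCoeff T J.card + (1 + 1 / (T : ℝ)) ^ T) *
      opt f k := by
  rw [searchPotential, potential, add_mul, Finset.sum_mul]
  refine add_le_add (Finset.sum_le_sum fun J _ => mul_le_mul_of_nonneg_left ?_
    (levelCoeff_nonneg _ _)) (mul_le_mul_of_nonneg_left ?_ (by positivity))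
  · have h1 : f (classUnion χ J) ≤ opt f k := le_optWithin (Finset.subset_univ _)
      ((Finset.card_le_card (classUnion_subset_solution χ J)).trans hχ.le)
    have h2 : 0 ≤ ∑ v ∈ classUnion χ J, topMarginal f v :=
      Finset.sum_nonneg fun v _ => topMarginal_nonneg hf.mono v
    rw [curvedPart]
    linarith
  · exact (sum_topMarginal_le (hf.nonneg _) hf.submodular _).trans
      (le_optWithin (Finset.subset_univ _) hχ.le)

theorem localSearch_approx (hT : 0 < T) (hκ : κ ≤ 1) {δ : ℝ} (hδ : 0 < δ)
    (hTδ : 1 / (1 + 1 / (T : ℝ)) ^ T ≤ 1 / Real.exp 1 + δ) {K : ℕ}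
    (hK : (∑ J : Finset (Fin T), levelCoeff T J.card + (1 + 1 / (T : ℝ)) ^ T) <
      K * ((1 + 1 / (T : ℝ)) ^ T * δ)) {k : ℕ} (hk : 0 < k) (hkV : k ≤ Fintype.card V)
    (hκ0 : 0 ≤ κ) (hf : IsBoundedCurvature κ f) {χ : V → Option (Fin T)}
    (hχ : (solution χ).card = k) (B : Finset V) :
    (1 - κ / Real.exp 1 - 2 * δ) * opt f k ≤
      f ((localSearch (K * Fintype.card V) χ B).run f) := by
  obtain ⟨O, hOk, hO⟩ := exists_card_eq_opt hf.mono hkV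
  have hOne : O.Nonempty := Finset.card_pos.1 (hOk ▸ hk)
  have hcurv := hf.curvedPart_le hκ hOne
  have hopt0 : 0 ≤ opt f k := hO ▸ hf.nonneg O
  set c : ℝ := (1 + 1 / (T : ℝ)) ^ T with hc
  have hc0 : 0 < c := by positivity
  have hk0 : (0 : ℝ) < k := by exact_mod_cast hk
  set τ : ℝ := (1 - κ / Real.exp 1 - 2 * δ) * opt f k with hτ
  have htarget : τ + δ * opt f k ≤ f O - curvedPart f O / c := by
    have h1 : curvedPart f O / c ≤ κ * f O * (1 / Real.exp 1 + δ) := by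
      rw [div_eq_mul_one_div]
      exact mul_le_mul hcurv hTδ (by positivity) (mul_nonneg hκ0 (hf.nonneg O))
    have h2 : κ * (δ * opt f k) ≤ 1 * (δ * opt f k) :=
      mul_le_mul_of_nonneg_right hκ (mul_nonneg hδ.le hopt0)
    rw [hO] at h1 ⊢
    have h3 : κ * opt f k * (1 / Real.exp 1 + δ) =
      κ / Real.exp 1 * opt f k + κ * (δ * opt f k) := by ring
    rw [hτ]
    linarith
  -- Below the target some swap gains at least the deficit, divided by the `k` exchanged pairs.
  have hstep : ∀ χ : V → Option (Fin T), (solution χ).card = k → f (solution χ) < τ →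
      ∃ χ' ∈ neighbors χ, searchPotential f χ + c * δ * opt f k / k ≤ searchPotential f χ' := by
    intro χ hχ hlt
    by_contra! hcon
    have h1 := le_of_swap_gain_le hT (monotone_curvedPart hf.submodular)
      (isSubmodular_curvedPart hf.submodular) (curvedPart_empty (f := f) ▸ hf.nonneg ∅)
      (topMarginal f) (hOk.trans hχ.symm) (G := c * δ * opt f k / k)
      (fun e he o ho j => by
        have := hcon _ (swap_mem_neighbors he ho j)
        simp only [searchPotential] at this
        linarith)
    rw [hOk, mul_div_cancel₀ _ hk0.ne', ← hc] at h1
    have h2 : curvedPart f (solution χ) + ∑ v ∈ solution χ, topMarginal f v = f (solution χ) := by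
      rw [curvedPart]; ring
    have h3 : ∑ v ∈ O, topMarginal f v = f O - curvedPart f O := by rw [curvedPart]; ring
    rw [h2, h3] at h1
    have h4 : c * (f (solution χ) + δ * opt f k) < c * (f O - curvedPart f O / c) :=
      mul_lt_mul_of_pos_left (by linarith) hc0
    rw [mul_sub, mul_div_cancel₀ _ hc0.ne'] at h4
    linarith
  obtain ⟨-, h | h⟩ := localSearch_progress (fun χ hχ => searchPotential_le hf hχ) hstep
    (K * Fintype.card V) χ B hχ
  · exact h
  · have h1 := searchPotential_nonneg hf χ
    rcases hopt0.eq_or_lt with h2 | h2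
    · rw [hτ, ← h2, mul_zero]
      exact hf.nonneg _
    · exfalso
      have h3 : K * (c * δ) * opt f k ≤
          (K * Fintype.card V : ℕ) * (c * δ * opt f k / k) := by
        have h4 : (k : ℝ) ≤ Fintype.card V := by exact_mod_cast hkV
        have h5 : 0 ≤ K * (c * δ) * opt f k := by positivity
        have h6 : ((K * Fintype.card V : ℕ) : ℝ) * (c * δ * opt f k / k) =
          K * (c * δ) * opt f k * (Fintype.card V / k) := by push_cast; ring
        rw [h6]
        exact le_mul_of_one_le_right h5 ((one_le_div hk0).2 h4)
      have h7 := mul_lt_mul_of_pos_right hK h2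
      linarith

theorem exists_pruning_of_approx {δ : ℝ} (hδ : 0 < δ) (hκ0 : 0 ≤ κ) (hκ : κ ≤ 1) :
    ∃ C : ℕ[X], ∀ n k p : ℕ, k ≤ p →
      ∃ A : RandAlg (Fin n), A.IsPruner κ (C.eval n) p ∧
        ∀ f : Finset (Fin n) → ℝ, IsBoundedCurvature κ f →
          (1 - κ / Real.exp 1 - δ) * opt f k ≤ A.expectedContainedValue f k := by
  obtain ⟨T, hT, hTδ⟩ : ∃ T : ℕ, 0 < T ∧ 1 / (1 + 1 / (T : ℝ)) ^ T ≤ 1 / Real.exp 1 + δ / 2 := by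
    have h1 : Filter.Tendsto (fun T : ℕ => 1 / (1 + 1 / (T : ℝ)) ^ T) Filter.atTop
        (nhds (1 / Real.exp 1)) :=
      tendsto_const_nhds.div (Real.tendsto_one_add_div_pow_exp 1) (Real.exp_pos 1).ne'
    obtain ⟨T, h2, h3⟩ := ((h1.eventually (eventually_le_nhds
      (show 1 / Real.exp 1 < 1 / Real.exp 1 + δ / 2 by linarith))).and
      (Filter.eventually_gt_atTop 0)).exists
    exact ⟨T, h3, h2⟩
  set c : ℝ := (1 + 1 / (T : ℝ)) ^ T with hc
  have hc0 : 0 < c := by positivity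
  obtain ⟨K, hK⟩ := exists_nat_gt ((∑ J : Finset (Fin T), levelCoeff T J.card + c) / (c * (δ / 2)))
  rw [div_lt_iff₀ (by positivity)] at hK
  let C : ℕ[X] := .C K * .X * (.X + (.X * (.X * .C T) + 1) * .C (2 ^ T) + .C 3)
  have hC : ∀ n, C.eval n = K * n * (n + (n * (n * T) + 1) * 2 ^ T + 3) := fun n => by
    simp only [C, Polynomial.eval_add, Polynomial.eval_mul, Polynomial.eval_C, Polynomial.eval_X,
      Polynomial.eval_one]
  refine ⟨C, fun n k p hkp => ?_⟩
  rcases Nat.eq_zero_or_pos k with rfl | hk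
  · refine ⟨.ofQueryAlg (.output ∅), fun f _ _ => by
      simp [RandAlg.ofQueryAlg, QueryAlg.run, QueryAlg.numQueries], fun f hf => ?_⟩
    rw [RandAlg.expectedContainedValue_ofQueryAlg]
    have h1 : opt f 0 ≤ f ∅ := optWithin_le fun S _ hS => by
      rw [Finset.card_eq_zero.1 (Nat.le_zero.1 hS)]
    have h2 : f ∅ ≤ optWithin f ((QueryAlg.output ∅).run f) 0 :=
      le_optWithin (Finset.empty_subset _) (by simp)
    have h3 : 0 ≤ opt f 0 := (hf.nonneg ∅).trans (le_optWithin (Finset.empty_subset _) (by simp))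
    have h4 : 0 ≤ κ / Real.exp 1 := by positivity
    exact (mul_le_of_le_one_left h3 (by linarith)).trans (h1.trans h2)
  rcases lt_or_ge n k with hnk | hkn
  · refine ⟨.ofQueryAlg (.output Finset.univ), fun f _ _ => ?_, fun f hf => ?_⟩
    · simp only [RandAlg.ofQueryAlg, QueryAlg.run, QueryAlg.numQueries, Finset.card_univ,
        Fintype.card_fin]
      omega
    rw [RandAlg.expectedContainedValue_ofQueryAlg]
    have h3 : 0 ≤ opt f k := (hf.nonneg ∅).trans (le_optWithin (Finset.empty_subset _) (by simp))
    have h4 : 0 ≤ κ / Real.exp 1 := by positivity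
    exact mul_le_of_le_one_left h3 (by linarith)
  -- The search may start from any `k`-set, all of it in one class.
  obtain ⟨B, -, hB⟩ := Finset.exists_subset_card_eq (s := (Finset.univ : Finset (Fin n))) (n := k)
    (by simpa using hkn)
  let χ : Fin n → Option (Fin T) := fun v => if v ∈ B then some ⟨0, hT⟩ else none
  have hχ : (solution χ).card = k := by
    rw [← hB]
    congr 1
    ext v
    by_cases hv : v ∈ B <;> simp [mem_solution, χ, hv]
  refine ⟨.ofQueryAlg (localSearch (K * n) χ B), fun f _ _ => ?_, fun f hf => ?_⟩
  · obtain ⟨h1, h2⟩ := localSearch_bounds f (K * n) χ B hχ hB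
    rw [Fintype.card_fin] at h2
    exact ⟨h2.trans_eq (hC n).symm, h1.trans_le hkp⟩
  · rw [RandAlg.expectedContainedValue_ofQueryAlg]
    have h1 := localSearch_approx hT hκ (half_pos hδ) hTδ hK hk (by simpa using hkn) hκ0 hf hχ B
    rw [Fintype.card_fin, mul_div_cancel₀ δ two_ne_zero] at h1
    obtain ⟨h2, -⟩ := localSearch_bounds f (K * n) χ B hχ hB
    exact h1.trans (le_optWithin subset_rfl h2.le)

end Tightness

/-! ### The hard instances -/

section HardInstance

/-- The value still missing after `i` generic elements: geometric decay at rate `1 - 1 / k` up to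
`i = k`, then linear decay to `0`, which is reached at `i = 2 * k`. The subtractions are truncated:
`i - k` is the excess of `i` over `k`. -/
noncomputable def decay (k i : ℕ) : ℝ :=
  (1 - 1 / (k : ℝ)) ^ min i k * ((k - (i - k) : ℕ) / k)

variable {k : ℕ}

theorem base_nonneg (hk : 0 < k) : (0 : ℝ) ≤ 1 - 1 / (k : ℝ) := by
  have : (1 : ℝ) ≤ k := by exact_mod_cast hk
  rw [sub_nonneg, div_le_one (by linarith)]
  exact this

theorem base_le_one : (1 - 1 / (k : ℝ)) ≤ 1 := by
  have : (0 : ℝ) ≤ 1 / (k : ℝ) := by positivity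
  linarith

theorem decay_nonneg (hk : 0 < k) (i : ℕ) : 0 ≤ decay k i :=
  mul_nonneg (pow_nonneg (base_nonneg hk) _) (by positivity)

theorem decay_of_le (hk : 0 < k) {i : ℕ} (h : i ≤ k) : decay k i = (1 - 1 / (k : ℝ)) ^ i := by
  have : (k : ℝ) ≠ 0 := by exact_mod_cast hk.ne'
  rw [decay, min_eq_left h, Nat.sub_eq_zero_of_le h, Nat.sub_zero, div_self this, mul_one]

theorem decay_zero (hk : 0 < k) : decay k 0 = 1 := by
  rw [decay_of_le hk (Nat.zero_le k), pow_zero]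

theorem decay_eq_zero {i : ℕ} (h : 2 * k ≤ i) : decay k i = 0 := by
  rw [decay, Nat.sub_eq_zero_of_le (by omega)]
  simp

theorem decay_sub_succ (hk : 0 < k) (i : ℕ) : decay k i - decay k (i + 1) =
    if i < 2 * k then (1 - 1 / (k : ℝ)) ^ min i k / k else 0 := by
  have hk' : (k : ℝ) ≠ 0 := by exact_mod_cast hk.ne'
  split_ifs with h
  · rcases lt_or_ge i k with h1 | h1
    · rw [decay_of_le hk h1.le, decay_of_le hk h1, min_eq_left h1.le, pow_succ]
      ring
    · have h2 : k - (i - k) = (k - (i + 1 - k)) + 1 := by omega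
      rw [decay, decay, min_eq_right h1, min_eq_right (h1.trans i.le_succ), h2]
      push_cast
      ring
  · rw [decay_eq_zero (by omega), decay_eq_zero (by omega), sub_zero]

theorem decay_sub_succ_nonneg (hk : 0 < k) (i : ℕ) : 0 ≤ decay k i - decay k (i + 1) := by
  rw [decay_sub_succ hk]
  split_ifs
  · exact div_nonneg (pow_nonneg (base_nonneg hk) _) (Nat.cast_nonneg k)
  · exact le_rfl

theorem decay_antitone (hk : 0 < k) : Antitone (decay k) :=
  antitone_nat_of_succ_le fun i => sub_nonneg.1 (decay_sub_succ_nonneg hk i)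

theorem decay_sub_succ_antitone (hk : 0 < k) :
    Antitone fun i => decay k i - decay k (i + 1) := by
  intro i j hij
  by_cases h : j < 2 * k
  · simp only [decay_sub_succ hk, if_pos h, if_pos (hij.trans_lt h)]
    gcongr ?_ / _
    exact pow_le_pow_of_le_one (base_nonneg hk) base_le_one (min_le_min_right k hij)
  · have h1 := decay_sub_succ_nonneg hk i
    simpa only [decay_sub_succ hk j, if_neg h] using h1

/-- The drop of `decay` is at least a fraction `1 / k` of what is left, so that `k` hidden elements
can supply everything that is missing. -/
theorem decay_div_le (hk : 0 < k) (i : ℕ) : decay k i / k ≤ decay k i - decay k (i + 1) := by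
  have hk' : (0 : ℝ) < k := by exact_mod_cast hk
  rw [decay_sub_succ hk]
  split_ifs with h
  · gcongr
    rw [decay]
    refine mul_le_of_le_one_right (pow_nonneg (base_nonneg hk) _) ?_
    rw [div_le_one hk']
    exact_mod_cast Nat.sub_le _ _
  · rw [decay_eq_zero (by omega), zero_div]

/-- The value of a set with `a` hidden and `b` other elements. The first `t` hidden elements count
like other elements, so that they do not reveal the hidden set; the later ones add linearly. -/
noncomputable def profile (k t a b : ℕ) : ℝ :=
  1 - decay k (b + min a t) * (1 - (a - t : ℕ) / k)

/-- The gain of a hidden element. -/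
theorem profile_succ_left (hk : 0 < k) (t a b : ℕ) :
    profile k t (a + 1) b - profile k t a b =
      if a < t then decay k (b + a) - decay k (b + a + 1) else decay k (b + t) / k := by
  have hk' : (k : ℝ) ≠ 0 := by exact_mod_cast hk.ne'
  split_ifs with h
  · rw [profile, profile, min_eq_left h.le, min_eq_left (Nat.succ_le_of_lt h),
      Nat.sub_eq_zero_of_le h.le, Nat.sub_eq_zero_of_le (Nat.succ_le_of_lt h), Nat.succ_eq_add_one,
      ← add_assoc]
    push_cast
    ring
  · have h1 : a + 1 - t = (a - t) + 1 := by omega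
    rw [profile, profile, min_eq_right (not_lt.1 h), min_eq_right (by omega), h1]
    push_cast
    ring

/-- The gain of an element that is not hidden. -/
theorem profile_succ_right (t a b : ℕ) :
    profile k t a (b + 1) - profile k t a b =
      (decay k (b + min a t) - decay k (b + min a t + 1)) * (1 - (a - t : ℕ) / k) := by
  rw [profile, profile, add_right_comm]
  ring

theorem sub_div_le_one {a t : ℕ} (hk : 0 < k) (ha : a ≤ k) : ((a - t : ℕ) : ℝ) / k ≤ 1 := by
  rw [div_le_one (by exact_mod_cast hk)]
  exact_mod_cast (Nat.sub_le _ _).trans ha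

theorem profile_succ_left_nonneg (hk : 0 < k) (t a b : ℕ) :
    0 ≤ profile k t (a + 1) b - profile k t a b := by
  rw [profile_succ_left hk]
  split_ifs
  · exact decay_sub_succ_nonneg hk _
  · exact div_nonneg (decay_nonneg hk _) (Nat.cast_nonneg k)

theorem profile_succ_right_nonneg (hk : 0 < k) {t a b : ℕ} (ha : a ≤ k) :
    0 ≤ profile k t a (b + 1) - profile k t a b := by
  rw [profile_succ_right]
  exact mul_nonneg (decay_sub_succ_nonneg hk _) (sub_nonneg.2 (sub_div_le_one hk ha))

/-- Diminishing returns for hidden elements. Across the threshold `t`, this is `decay_div_le`. -/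
theorem profile_succ_left_antitone (hk : 0 < k) {t a a' b b' : ℕ} (ha : a ≤ a') (hb : b ≤ b') :
    profile k t (a' + 1) b' - profile k t a' b' ≤ profile k t (a + 1) b - profile k t a b := by
  rw [profile_succ_left hk, profile_succ_left hk]
  split_ifs with h1 h2 h2
  · exact decay_sub_succ_antitone hk (add_le_add hb ha)
  · omega
  · refine (div_le_div_of_nonneg_right (decay_antitone hk ?_) (Nat.cast_nonneg k)).trans
      (decay_div_le hk _)
    omega
  · exact div_le_div_of_nonneg_right (decay_antitone hk (by omega)) (Nat.cast_nonneg k)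

theorem profile_succ_right_antitone (hk : 0 < k) {t a a' b b' : ℕ} (ha : a ≤ a') (hb : b ≤ b')
    (ha' : a' ≤ k) :
    profile k t a' (b' + 1) - profile k t a' b' ≤ profile k t a (b + 1) - profile k t a b := by
  rw [profile_succ_right, profile_succ_right]
  refine mul_le_mul (decay_sub_succ_antitone hk (add_le_add hb (min_le_min_right t ha))) ?_
    (sub_nonneg.2 (sub_div_le_one hk ha')) (decay_sub_succ_nonneg hk _)
  gcongr

variable {V : Type} [DecidableEq V]

/-- The hard function with hidden set `O`. For `O = ∅` nothing is hidden. -/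
noncomputable def hiddenFun (κ : ℝ) (k t : ℕ) (O S : Finset V) : ℝ :=
  κ * profile k t (S ∩ O).card (S \ O).card + (1 - κ) * (S.card / k)

theorem marginalGain_hiddenFun {κ : ℝ} {t : ℕ} {O A : Finset V} {x : V} (hx : x ∉ A) :
    marginalGain (hiddenFun κ k t O) x A = κ * (if x ∈ O then
        profile k t ((A ∩ O).card + 1) (A \ O).card - profile k t (A ∩ O).card (A \ O).card
      else
        profile k t (A ∩ O).card ((A \ O).card + 1) - profile k t (A ∩ O).card (A \ O).card) +
      (1 - κ) * (1 / k) := by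
  rw [marginalGain, hiddenFun, hiddenFun, Finset.card_insert_of_notMem hx]
  push_cast
  split_ifs with h
  · rw [Finset.insert_inter_of_mem h, Finset.insert_sdiff_of_mem _ h,
      Finset.card_insert_of_notMem fun h' => hx (Finset.mem_inter.1 h').1]
    ring
  · rw [Finset.insert_inter_of_notMem h, Finset.insert_sdiff_of_notMem _ h,
      Finset.card_insert_of_notMem fun h' => hx (Finset.mem_sdiff.1 h').1]
    ring

theorem le_marginalGain_hiddenFun {κ : ℝ} (hκ0 : 0 ≤ κ) (hk : 0 < k) {t : ℕ} {O A : Finset V}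
    (hO : O.card ≤ k) {x : V} (hx : x ∉ A) :
    (1 - κ) * (1 / k) ≤ marginalGain (hiddenFun κ k t O) x A := by
  rw [marginalGain_hiddenFun hx, le_add_iff_nonneg_left]
  refine mul_nonneg hκ0 ?_
  split_ifs
  · exact profile_succ_left_nonneg hk _ _ _
  · exact profile_succ_right_nonneg hk ((Finset.card_le_card Finset.inter_subset_right).trans hO)

theorem hiddenFun_empty (κ : ℝ) (hk : 0 < k) (t : ℕ) (O : Finset V) :
    hiddenFun κ k t O ∅ = 0 := by
  simp [hiddenFun, profile, decay_zero hk]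

theorem hiddenFun_singleton (κ : ℝ) (hk : 0 < k) (t : ℕ) (O : Finset V) (x : V) :
    hiddenFun κ k t O {x} = 1 / k := by
  have h := marginalGain_hiddenFun (κ := κ) (k := k) (t := t) (O := O) (Finset.notMem_empty x)
  have h0 : decay k 0 - decay k 1 = 1 / k := by
    rw [decay_sub_succ hk, if_pos (by omega), Nat.zero_min, pow_zero]
  rw [marginalGain, insert_empty_eq, hiddenFun_empty κ hk, sub_zero, Finset.empty_inter,
    Finset.empty_sdiff, Finset.card_empty, profile_succ_left hk, profile_succ_right] at h
  rw [h]
  split_ifs with h1 h2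
  · simp only [add_zero, zero_add, h0]; ring
  · rw [Nat.eq_zero_of_not_pos h2, add_zero, decay_zero hk]; ring
  · simp only [Nat.zero_min, zero_add, add_zero, Nat.zero_sub, h0]; push_cast; ring

theorem isBoundedCurvature_hiddenFun [Fintype V] {κ : ℝ} (hκ0 : 0 ≤ κ) (hκ : κ ≤ 1) (hk : 0 < k)
    (t : ℕ) {O : Finset V} (hO : O.card ≤ k) : IsBoundedCurvature κ (hiddenFun κ k t O) := by
  have hmono : Monotone (hiddenFun κ k t O) := monotone_of_le_insert fun x A hx => by
    have h1 := le_marginalGain_hiddenFun hκ0 hk (t := t) hO hx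
    have h2 : 0 ≤ (1 - κ) * (1 / k) := mul_nonneg (sub_nonneg.2 hκ) (by positivity)
    rw [marginalGain] at h1
    linarith
  have hnonneg : ∀ S, 0 ≤ hiddenFun κ k t O S := fun S =>
    hiddenFun_empty κ hk t O ▸ hmono (Finset.empty_subset S)
  refine ⟨hnonneg, hmono, fun A B hAB x hx => ?_, totalCurvature_le hκ0 hnonneg fun j => ?_⟩
  · rw [marginalGain_hiddenFun hx, marginalGain_hiddenFun fun h => hx (hAB h)]
    have ha := Finset.card_le_card (Finset.inter_subset_inter_right (u := O) hAB)
    have hb := Finset.card_le_card (Finset.sdiff_subset_sdiff hAB (subset_refl O))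
    gcongr ?_ * ?_ + _
    split_ifs
    · exact profile_succ_left_antitone hk ha hb
    · exact profile_succ_right_antitone hk ha hb
        ((Finset.card_le_card Finset.inter_subset_right).trans hO)
  · rw [hiddenFun_singleton κ hk]
    exact le_marginalGain_hiddenFun hκ0 hk hO (Finset.notMem_erase j _)

/-- A query reveals nothing about `O` if the set has few elements in common with `O`, or is so large
that the curved part of the function is constant. -/
theorem hiddenFun_eq {κ : ℝ} {t : ℕ} {O S : Finset V} (hO : O.card ≤ k)
    (h : (S ∩ O).card ≤ t ∨ 3 * k ≤ S.card) : hiddenFun κ k t O S = hiddenFun κ k t ∅ S := by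
  have h1 := Finset.card_sdiff_add_card_inter S O
  have h2 := Finset.card_le_card (Finset.inter_subset_right (s₁ := S) (s₂ := O))
  have h3 : profile k t (S ∩ O).card (S \ O).card = profile k t 0 S.card := by
    by_cases h4 : (S ∩ O).card ≤ t
    · rw [profile, profile, min_eq_left h4, h1, Nat.sub_eq_zero_of_le h4]
      simp
    · have h5 := h.resolve_left h4
      rw [profile, profile, decay_eq_zero (by omega), decay_eq_zero (by omega)]
      simp
  rw [hiddenFun, hiddenFun, h3]
  simp

theorem profile_le_one (hk : 0 < k) {t a b : ℕ} (ha : a ≤ k) : profile k t a b ≤ 1 :=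
  sub_le_self _ (mul_nonneg (decay_nonneg hk _) (sub_nonneg.2 (sub_div_le_one hk ha)))

theorem hiddenFun_le_one {κ : ℝ} (hκ0 : 0 ≤ κ) (hκ : κ ≤ 1) (hk : 0 < k) {t : ℕ} {O S : Finset V}
    (hO : O.card ≤ k) (hS : S.card ≤ k) : hiddenFun κ k t O S ≤ 1 := by
  have hk' : (0 : ℝ) < k := by exact_mod_cast hk
  have h1 := mul_le_mul_of_nonneg_left (profile_le_one hk (t := t) (b := (S \ O).card)
    ((Finset.card_le_card (Finset.inter_subset_right (s₁ := S))).trans hO)) hκ0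
  have h2 : (S.card : ℝ) / k ≤ 1 := (div_le_one hk').2 (by exact_mod_cast hS)
  have h3 := mul_le_mul_of_nonneg_left h2 (sub_nonneg.2 hκ)
  rw [hiddenFun]
  linarith

/-- A small set exceeds the value of a generic `k`-set only by its share of hidden elements. -/
theorem hiddenFun_le {κ : ℝ} (hκ0 : 0 ≤ κ) (hκ : κ ≤ 1) (hk : 0 < k) {t : ℕ} {O S : Finset V}
    (hO : O.card ≤ k) (hS : S.card ≤ k) : hiddenFun κ k t O S ≤
      1 - κ * (1 - 1 / (k : ℝ)) ^ k + κ * ((S ∩ O).card / k) := by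
  have hk' : (0 : ℝ) < k := by exact_mod_cast hk
  have h1 := Finset.card_sdiff_add_card_inter S O
  have h2 := Finset.card_le_card (Finset.inter_subset_right (s₁ := S) (s₂ := O))
  set a := (S ∩ O).card
  set q : ℝ := (1 - 1 / (k : ℝ)) ^ k with hq
  have hq0 : 0 ≤ q := pow_nonneg (base_nonneg hk) _
  have hq1 : q ≤ 1 := pow_le_one₀ (base_nonneg hk) base_le_one
  have hx0 : (0 : ℝ) ≤ (a - t : ℕ) / k := by positivity
  have hx1 : ((a - t : ℕ) : ℝ) / k ≤ 1 := sub_div_le_one hk (h2.trans hO)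
  have hx2 : ((a - t : ℕ) : ℝ) / k ≤ a / k := by
    gcongr
    exact Nat.sub_le _ _
  have h3 : q ≤ decay k ((S \ O).card + min a t) := by
    rw [hq, ← decay_of_le hk le_rfl]
    exact decay_antitone hk (by omega)
  have h4 : profile k t a (S \ O).card ≤ 1 - q + a / k := by
    have h5 := mul_le_mul_of_nonneg_right h3 (sub_nonneg.2 hx1)
    have h6 := mul_le_mul_of_nonneg_right hq1 hx0
    rw [profile]
    linarith
  have h7 := mul_le_mul_of_nonneg_left h4 hκ0
  have h8 : (S.card : ℝ) / k ≤ 1 := (div_le_one hk').2 (by exact_mod_cast hS)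
  have h9 := mul_le_mul_of_nonneg_left h8 (sub_nonneg.2 hκ)
  rw [hiddenFun]
  linarith

theorem le_hiddenFun_self {κ : ℝ} (hκ : κ ≤ 1) (hk : 0 < k) {t : ℕ} (ht : t ≤ k)
    {O : Finset V} (hO : O.card = k) : 1 - (t : ℝ) / k ≤ hiddenFun κ k t O O := by
  have hk' : (k : ℝ) ≠ 0 := by exact_mod_cast hk.ne'
  have h1 : (0 : ℝ) ≤ t / k := by positivity
  have h2 : decay k (min k t) * (t / k) ≤ 1 * (t / k) :=
    mul_le_mul_of_nonneg_right (decay_zero hk ▸ decay_antitone hk (Nat.zero_le _)) h1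
  have h3 : hiddenFun κ k t O O = 1 - κ * (decay k (min k t) * (t / k)) := by
    rw [hiddenFun, profile, Finset.inter_self, sdiff_self, Finset.bot_eq_empty, Finset.card_empty,
      hO, zero_add, Nat.cast_sub ht, div_self hk', sub_div, div_self hk']
    ring
  have h4 : κ * (decay k (min k t) * (t / k)) ≤ 1 * (decay k (min k t) * (t / k)) :=
    mul_le_mul_of_nonneg_right hκ (mul_nonneg (decay_nonneg hk _) h1)
  rw [h3]
  linarith

end HardInstance

/-! ### Uniformly random `k`-subsets -/

section RandomSubset

variable {V : Type} [Fintype V] [DecidableEq V]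

theorem card_filter_subset_powersetCard {k : ℕ} {T : Finset V} (hT : T.card ≤ k) :
    ((Finset.univ.powersetCard k).filter (T ⊆ ·)).card =
      (Fintype.card V - T.card).choose (k - T.card) := by
  rw [← Finset.card_compl, ← Finset.card_powersetCard]
  refine Finset.card_bij' (fun O _ => O \ T) (fun A _ => A ∪ T) ?_ ?_ ?_ ?_
  · intro O hO
    simp only [Finset.mem_filter, Finset.mem_powersetCard, Finset.subset_univ, true_and] at hO
    rw [Finset.mem_powersetCard, Finset.card_sdiff_of_subset hO.2, hO.1]
    exact ⟨fun x hx => Finset.mem_compl.2 (Finset.mem_sdiff.1 hx).2, rfl⟩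
  · intro A hA
    rw [Finset.mem_powersetCard] at hA
    have hd : Disjoint A T := Finset.disjoint_left.2 fun x hx => Finset.mem_compl.1 (hA.1 hx)
    simp only [Finset.mem_filter, Finset.mem_powersetCard, Finset.subset_univ, true_and]
    rw [Finset.card_union_of_disjoint hd, hA.2]
    exact ⟨Nat.sub_add_cancel hT, Finset.subset_union_right⟩
  · intro O hO
    simp only [Finset.mem_filter] at hO
    exact Finset.sdiff_union_of_subset hO.2
  · intro A hA
    rw [Finset.mem_powersetCard] at hA
    have hd : Disjoint A T := Finset.disjoint_left.2 fun x hx => Finset.mem_compl.1 (hA.1 hx)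
    rw [Finset.union_sdiff_right, Finset.sdiff_eq_self_of_disjoint hd]

theorem choose_sub_mul_pow_le {n k : ℕ} (hkn : k ≤ n) (r : ℕ) (hr : r ≤ k) :
    (n - r).choose (k - r) * n ^ r ≤ k ^ r * n.choose k := by
  induction r with
  | zero => simp
  | succ r ih =>
    have h1 := Nat.add_one_mul_choose_eq (n - (r + 1)) (k - (r + 1))
    rw [show n - (r + 1) + 1 = n - r by omega, show k - (r + 1) + 1 = k - r by omega] at h1
    have h2 : (n - (r + 1)).choose (k - (r + 1)) * n ≤ k * (n - r).choose (k - r) := by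
      have h3 : (k - r) * n ≤ k * (n - r) := by
        zify [show r ≤ k by omega, show r ≤ n by omega]
        nlinarith
      have h4 : 0 < n - r := by omega
      refine Nat.le_of_mul_le_mul_left ?_ h4
      calc (n - r) * ((n - (r + 1)).choose (k - (r + 1)) * n)
          = (n - r).choose (k - r) * ((k - r) * n) := by rw [← mul_assoc, h1, mul_assoc]
        _ ≤ (n - r).choose (k - r) * (k * (n - r)) := Nat.mul_le_mul_left _ h3
        _ = (n - r) * (k * (n - r).choose (k - r)) := by ring
    calc (n - (r + 1)).choose (k - (r + 1)) * n ^ (r + 1)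
        = (n - (r + 1)).choose (k - (r + 1)) * n * n ^ r := by ring
      _ ≤ k * (n - r).choose (k - r) * n ^ r := Nat.mul_le_mul_right _ h2
      _ = k * ((n - r).choose (k - r) * n ^ r) := by ring
      _ ≤ k * (k ^ r * n.choose k) := Nat.mul_le_mul_left _ (ih (by omega))
      _ = k ^ (r + 1) * n.choose k := by ring

/-- A random `k`-subset contains a given set `T` with probability at most `(k / n) ^ |T|`. -/
theorem card_filter_subset_mul_pow_le {k : ℕ} (hk : k ≤ Fintype.card V) (T : Finset V) :
    ((Finset.univ.powersetCard k).filter (T ⊆ ·)).card * Fintype.card V ^ T.card ≤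
      k ^ T.card * (Fintype.card V).choose k := by
  by_cases hT : T.card ≤ k
  · rw [card_filter_subset_powersetCard hT]
    exact choose_sub_mul_pow_le hk _ hT
  · rw [Finset.filter_false_of_mem, Finset.card_empty, zero_mul]
    · exact Nat.zero_le _
    · intro O hO hTO
      exact hT ((Finset.mem_powersetCard.1 hO).2 ▸ Finset.card_le_card hTO)

/-- A random `k`-subset meets `P` in at most `|P| k / n` elements on average. -/
theorem sum_card_inter_mul_le {k : ℕ} (hk : k ≤ Fintype.card V) (P : Finset V) :
    (∑ O ∈ Finset.univ.powersetCard k, (P ∩ O).card) * Fintype.card V ≤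
      P.card * (k * (Fintype.card V).choose k) := by
  have h1 : ∀ O : Finset V, (P ∩ O).card = ∑ v ∈ P, if {v} ⊆ O then 1 else 0 := fun O => by
    rw [← Finset.filter_mem_eq_inter, Finset.card_filter]
    simp
  simp_rw [h1]
  rw [Finset.sum_comm, Finset.sum_mul, ← smul_eq_mul P.card]
  refine Finset.sum_le_card_nsmul _ _ _ fun v _ => ?_
  rw [← Finset.card_filter]
  simpa using card_filter_subset_mul_pow_le hk {v}

/-- A union bound over the `(t + 1)`-subsets of `S`. -/
theorem card_filter_lt_inter_mul_pow_le {k : ℕ} (hk : k ≤ Fintype.card V) (S : Finset V) (t : ℕ) :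
    ((Finset.univ.powersetCard k).filter fun O => t < (S ∩ O).card).card *
        Fintype.card V ^ (t + 1) ≤
      S.card.choose (t + 1) * (k ^ (t + 1) * (Fintype.card V).choose k) := by
  have h1 : ((Finset.univ.powersetCard k).filter fun O => t < (S ∩ O).card) ⊆
      (S.powersetCard (t + 1)).biUnion fun T => (Finset.univ.powersetCard k).filter (T ⊆ ·) := by
    intro O hO
    rw [Finset.mem_filter] at hO
    obtain ⟨T, hT, hTc⟩ := Finset.exists_subset_card_eq (s := S ∩ O) (n := t + 1) hO.2
    rw [Finset.subset_inter_iff] at hT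
    exact Finset.mem_biUnion.2 ⟨T, Finset.mem_powersetCard.2 ⟨hT.1, hTc⟩,
      Finset.mem_filter.2 ⟨hO.1, hT.2⟩⟩
  refine (Nat.mul_le_mul_right _ ((Finset.card_le_card h1).trans Finset.card_biUnion_le)).trans ?_
  rw [Finset.sum_mul, ← Finset.card_powersetCard, ← smul_eq_mul (Finset.card _)]
  refine Finset.sum_le_card_nsmul _ _ _ fun T hT => ?_
  have h2 := card_filter_subset_mul_pow_le hk T
  rwa [(Finset.mem_powersetCard.1 hT).2] at h2

end RandomSubset

/-! ### Algorithms on hidden instances -/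

/-- The sets queried on the oracle `f`. -/
def QueryAlg.queries {V : Type} (f : Finset V → ℝ) : QueryAlg V → List (Finset V)
  | .output _ => []
  | .query S next => S :: (next (f S)).queries f

theorem QueryAlg.length_queries {V : Type} (f : Finset V → ℝ) (A : QueryAlg V) :
    (A.queries f).length = A.numQueries f := by
  induction A with
  | output P => rfl
  | query S next ih => simp [QueryAlg.queries, QueryAlg.numQueries, ih]

theorem QueryAlg.run_congr {V : Type} {f g : Finset V → ℝ} {A : QueryAlg V}
    (h : ∀ S ∈ A.queries f, g S = f S) : A.run g = A.run f := by
  induction A with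
  | output P => rfl
  | query S next ih =>
    have h1 : g S = f S := h S (by simp [QueryAlg.queries])
    rw [QueryAlg.run, QueryAlg.run, h1]
    exact ih _ fun S' hS' => h S' (by simp [QueryAlg.queries, hS'])

section Hardness

variable {V : Type} [Fintype V]

theorem RandAlg.integrable_comp_run (A : RandAlg V) (f : Finset V → ℝ) (u : Finset V → ℝ) :
    Integrable (fun ω => u ((A.alg ω).run f)) A.μ := by
  let _ : MeasurableSpace (Finset V) := ⊤
  have hmeas : Measurable fun ω => (A.alg ω).run f :=
    measurable_to_countable' fun P => A.measurable_run f P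
  have : IsProbabilityMeasure (A.μ.map fun ω => (A.alg ω).run f) :=
    Measure.isProbabilityMeasure_map hmeas.aemeasurable
  exact (Integrable.of_finite (f := u)).comp_measurable hmeas

theorem RandAlg.expectedContainedValue_le_opt (A : RandAlg V) (f : Finset V → ℝ) (k : ℕ) :
    A.expectedContainedValue f k ≤ opt f k := by
  have h := integral_mono (A.integrable_comp_run f fun P => optWithin f P k)
    (integrable_const (opt f k)) fun ω => optWithin_le_opt f ((A.alg ω).run f) k
  simpa [RandAlg.expectedContainedValue] using h

variable [DecidableEq V] {κ : ℝ} {k t p q : ℕ}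

/-- A deterministic algorithm cannot do well on the average over the hidden set: its run is the same
as on the oracle hiding nothing, unless a query of fewer than `3 * k` elements has more than `t`
elements in common with the hidden set. -/
theorem sum_optWithin_hiddenFun_le (hκ0 : 0 ≤ κ) (hκ : κ ≤ 1) (hk : 0 < k)
    (hkV : k ≤ Fintype.card V) {A : QueryAlg V} (hq : A.numQueries (hiddenFun κ k t ∅) ≤ q)
    (hp : (A.run (hiddenFun κ k t ∅)).card ≤ p) :
    ∑ O ∈ Finset.univ.powersetCard k,
        optWithin (hiddenFun κ k t O) (A.run (hiddenFun κ k t O)) k ≤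
      ((Finset.univ : Finset V).powersetCard k).card • (1 - κ * (1 - 1 / (k : ℝ)) ^ k +
        κ * (p / Fintype.card V) +
        q * ((3 * k).choose (t + 1) * ((k : ℝ) / Fintype.card V) ^ (t + 1))) := by
  set n := Fintype.card V with hn
  have hn0 : (0 : ℝ) < n := by exact_mod_cast hk.trans_le hkV
  have hk0 : (0 : ℝ) < k := by exact_mod_cast hk
  set N : ℕ := ((Finset.univ : Finset V).powersetCard k).card with hN
  have hNc : n.choose k = N := by rw [hN, Finset.card_powersetCard, Finset.card_univ]
  set P := A.run (hiddenFun κ k t ∅) with hP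
  let L : Finset (Finset V) :=
    (A.queries (hiddenFun κ k t ∅)).toFinset.filter fun S => S.card < 3 * k
  -- The hidden sets that some query reveals. On them the value is still at most `1`.
  let bad : Finset (Finset V) :=
    (Finset.univ.powersetCard k).filter fun O => ∃ S ∈ L, t < (S ∩ O).card
  have hpt : ∀ O ∈ (Finset.univ : Finset V).powersetCard k,
      optWithin (hiddenFun κ k t O) (A.run (hiddenFun κ k t O)) k ≤
        1 - κ * (1 - 1 / (k : ℝ)) ^ k + κ * ((P ∩ O).card / k) + if O ∈ bad then 1 else 0 := by
    intro O hO
    have hOk : O.card = k := (Finset.mem_powersetCard.1 hO).2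
    split_ifs with hbad
    · have h1 : optWithin (hiddenFun κ k t O) (A.run (hiddenFun κ k t O)) k ≤ 1 :=
        optWithin_le fun S _ hS => hiddenFun_le_one hκ0 hκ hk hOk.le hS
      have h2 : κ * (1 - 1 / (k : ℝ)) ^ k ≤ 1 :=
        mul_le_one₀ hκ (pow_nonneg (base_nonneg hk) _)
          (pow_le_one₀ (base_nonneg hk) base_le_one)
      have h3 : 0 ≤ κ * (((P ∩ O).card : ℝ) / k) := by positivity
      linarith
    · have hrun : A.run (hiddenFun κ k t O) = P := QueryAlg.run_congr fun S hS => by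
        refine hiddenFun_eq hOk.le ?_
        by_contra! hcon
        refine hbad (Finset.mem_filter.2 ⟨hO, S, ?_, hcon.1⟩)
        exact Finset.mem_filter.2 ⟨List.mem_toFinset.2 hS, hcon.2⟩
      rw [hrun, add_zero]
      refine optWithin_le fun S hSP hS => (hiddenFun_le hκ0 hκ hk hOk.le hS).trans ?_
      gcongr
  refine (Finset.sum_le_sum hpt).trans ?_
  rw [Finset.sum_add_distrib, Finset.sum_add_distrib, Finset.sum_const, smul_add, smul_add]
  refine add_le_add (add_le_add le_rfl ?_) ?_
  · have h1 := sum_card_inter_mul_le hkV P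
    rw [← hn, hNc] at h1
    have h2 : (∑ O ∈ (Finset.univ : Finset V).powersetCard k, ((P ∩ O).card : ℝ)) * n ≤
        p * (k * N) := by
      refine le_trans (b := (P.card : ℝ) * (k * N)) (by exact_mod_cast h1) ?_
      gcongr
    rw [← Finset.mul_sum, ← Finset.sum_div, nsmul_eq_mul, mul_left_comm]
    refine mul_le_mul_of_nonneg_left ?_ hκ0
    rw [div_le_iff₀ hk0, ← mul_div_assoc, div_mul_eq_mul_div, le_div_iff₀ hn0]
    linarith
  · have h1 : bad ⊆ L.biUnion fun S =>
        (Finset.univ.powersetCard k).filter fun O => t < (S ∩ O).card := by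
      intro O hO
      obtain ⟨hO, S, hS, hSO⟩ := Finset.mem_filter.1 hO
      exact Finset.mem_biUnion.2 ⟨S, hS, Finset.mem_filter.2 ⟨hO, hSO⟩⟩
    have hL : L.card ≤ q := (Finset.card_filter_le _ _).trans
      ((List.toFinset_card_le _).trans ((QueryAlg.length_queries _ A).trans_le hq))
    have h2 : bad.card * n ^ (t + 1) ≤ q * ((3 * k).choose (t + 1) * (k ^ (t + 1) * N)) := by
      refine (Nat.mul_le_mul_right _
        ((Finset.card_le_card h1).trans Finset.card_biUnion_le)).trans ?_
      rw [Finset.sum_mul]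
      refine le_trans ?_ (Nat.mul_le_mul_right _ hL)
      rw [← smul_eq_mul L.card]
      refine Finset.sum_le_card_nsmul _ _ _ fun S hS => ?_
      refine (card_filter_lt_inter_mul_pow_le hkV S t).trans ?_
      rw [← hn, hNc]
      exact Nat.mul_le_mul_right _ (Nat.choose_le_choose _ (Finset.mem_filter.1 hS).2.le)
    have h3 : (bad.card : ℝ) * n ^ (t + 1) ≤
        q * ((3 * k).choose (t + 1) * (k ^ (t + 1) * N)) := by exact_mod_cast h2
    have h4 : ∑ O ∈ (Finset.univ : Finset V).powersetCard k, (if O ∈ bad then (1 : ℝ) else 0) =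
        bad.card := by
      rw [Finset.sum_boole, Finset.filter_mem_eq_inter,
        Finset.inter_eq_right.2 (Finset.filter_subset _ _)]
    rw [← le_div_iff₀ (by positivity)] at h3
    rw [h4, nsmul_eq_mul, div_pow]
    refine h3.trans_eq ?_
    ring

/-- Some hidden set defeats a given randomized algorithm: average over the hidden set and the coin
flips. -/
theorem RandAlg.exists_hiddenFun_le (A : RandAlg V) (hA : A.IsPruner κ q p) (hκ0 : 0 ≤ κ)
    (hκ : κ ≤ 1) (hk : 0 < k) (hkV : k ≤ Fintype.card V) (t : ℕ) :
    ∃ O : Finset V, O.card = k ∧ A.expectedContainedValue (hiddenFun κ k t O) k ≤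
      1 - κ * (1 - 1 / (k : ℝ)) ^ k + κ * (p / Fintype.card V) +
        q * ((3 * k).choose (t + 1) * ((k : ℝ) / Fintype.card V) ^ (t + 1)) := by
  have hne : ((Finset.univ : Finset V).powersetCard k).Nonempty :=
    Finset.powersetCard_nonempty.2 (by simpa using hkV)
  have hint : ∀ O ∈ (Finset.univ : Finset V).powersetCard k, Integrable
      (fun ω => optWithin (hiddenFun κ k t O) ((A.alg ω).run (hiddenFun κ k t O)) k) A.μ :=
    fun O _ => A.integrable_comp_run _ fun P => optWithin _ P k
  have hsum : ∑ O ∈ (Finset.univ : Finset V).powersetCard k,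
      A.expectedContainedValue (hiddenFun κ k t O) k ≤
      ∑ _O ∈ (Finset.univ : Finset V).powersetCard k, (1 - κ * (1 - 1 / (k : ℝ)) ^ k +
        κ * (p / Fintype.card V) +
        q * ((3 * k).choose (t + 1) * ((k : ℝ) / Fintype.card V) ^ (t + 1))) := by
    simp only [RandAlg.expectedContainedValue]
    rw [← integral_finsetSum _ hint, Finset.sum_const]
    refine (integral_mono (integrable_finsetSum _ hint) (integrable_const _) fun ω => ?_).trans_eq
      (by rw [integral_const, probReal_univ, one_smul])
    obtain ⟨h1, h2⟩ := hA _ (isBoundedCurvature_hiddenFun hκ0 hκ hk t (O := ∅) (by simp)) ω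
    exact sum_optWithin_hiddenFun_le hκ0 hκ hk hkV h1 h2
  obtain ⟨O, hO, h⟩ := Finset.exists_le_of_sum_le hne hsum
  exact ⟨O, (Finset.mem_powersetCard.1 hO).2, h⟩

end Hardness

/-! ### Asymptotic estimates -/

section Asymptotics

open Filter Topology

theorem choose_le_exp_mul_div_pow (s : ℕ) {r : ℕ} (hr : 0 < r) :
    (s.choose r : ℝ) ≤ (Real.exp 1 * s / r) ^ r := by
  have hr' : (0 : ℝ) < r := by exact_mod_cast hr
  have h1 : (s.choose r : ℝ) ≤ (s : ℝ) ^ r / r.factorial := Nat.choose_le_pow_div r s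
  have h2 : (r : ℝ) ^ r / r.factorial ≤ Real.exp r := Real.pow_div_factorial_le_exp _ hr'.le r
  refine h1.trans ?_
  have h3 : (Real.exp 1 * s / r) ^ r = (s : ℝ) ^ r * (Real.exp r / (r : ℝ) ^ r) := by
    rw [div_pow, mul_pow, ← Real.exp_nat_mul, mul_one]
    ring
  rw [h3, div_eq_mul_one_div]
  refine mul_le_mul_of_nonneg_left ?_ (by positivity)
  rw [le_div_iff₀ (by positivity), one_div, inv_mul_eq_div]
  exact h2

theorem eval_le_mul_pow (C : ℕ[X]) {n : ℕ} (hn : 0 < n) :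
    C.eval n ≤ C.eval 1 * n ^ C.natDegree := by
  rw [Polynomial.eval_eq_sum_range, Polynomial.eval_eq_sum_range, Finset.sum_mul]
  refine Finset.sum_le_sum fun i hi => ?_
  rw [one_pow, mul_one]
  exact Nat.mul_le_mul_left _
    (Nat.pow_le_pow_right hn (Nat.lt_succ_iff.1 (Finset.mem_range.1 hi)))

theorem tendsto_floor_mul_add_one {ε : ℝ} (hε : 0 < ε) :
    Tendsto (fun k : ℕ => ⌊ε * k / 2⌋₊ + 1) atTop atTop := by
  refine tendsto_atTop_mono (fun k => Nat.le_succ _) (tendsto_nat_floor_atTop.comp ?_)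
  exact (tendsto_natCast_atTop_atTop.const_mul_atTop hε).atTop_div_const two_pos

/-- Polynomially many queries find the hidden set with negligible probability. The bound is uniform
in `n`, which may be much larger than `k`. -/
theorem eventually_eval_mul_choose_le {ε : ℝ} (hε : 0 < ε) (C : ℕ[X]) {η : ℝ} (hη : 0 < η) :
    ∀ᶠ k : ℕ in atTop, ∀ n : ℕ, 60 * (k : ℝ) / ε ≤ n →
      ((C.eval n : ℕ) : ℝ) * ((3 * k).choose (⌊ε * k / 2⌋₊ + 1) *
        ((k : ℝ) / n) ^ (⌊ε * k / 2⌋₊ + 1)) ≤ η := by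
  set d := C.natDegree
  set A : ℝ := 6 * Real.exp 1 / ε with hA
  have hA0 : 0 < A := by positivity
  have hlim : Tendsto (fun k : ℕ => ((C.eval 1 : ℕ) : ℝ) * (A * (2 / ε)) ^ d * 2 ^ d *
      (((⌊ε * k / 2⌋₊ + 1 : ℕ) : ℝ) ^ d * (1 / 2 : ℝ) ^ (⌊ε * k / 2⌋₊ + 1))) atTop (𝓝 0) := by
    have h := (tendsto_pow_const_mul_const_pow_of_abs_lt_one d
      (show |(1 / 2 : ℝ)| < 1 by norm_num [abs_of_pos])).comp (tendsto_floor_mul_add_one hε)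
    simpa using h.const_mul (((C.eval 1 : ℕ) : ℝ) * (A * (2 / ε)) ^ d * 2 ^ d)
  filter_upwards [hlim.eventually (eventually_le_nhds hη), eventually_gt_atTop 0,
    (tendsto_floor_mul_add_one hε).eventually_ge_atTop d] with k hk hk0 hd n hn
  refine le_trans ?_ hk
  set r := ⌊ε * k / 2⌋₊ + 1 with hr
  have hk0' : (0 : ℝ) < k := by exact_mod_cast hk0
  have hn0' : (0 : ℝ) < n := lt_of_lt_of_le (by positivity) hn
  have hn0 : 0 < n := by exact_mod_cast hn0'
  have hrk : ε * k / 2 ≤ r := by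
    rw [hr]; push_cast; exact (Nat.lt_floor_add_one _).le
  have hr0 : (0 : ℝ) < r := lt_of_lt_of_le (by positivity) hrk
  have hkr : (k : ℝ) ≤ 2 / ε * r := by
    rw [div_mul_eq_mul_div, le_div_iff₀ hε]; linarith
  have h1 : ((3 * k).choose r : ℝ) * ((k : ℝ) / n) ^ r ≤ (A * k / n) ^ r := by
    have h2 := choose_le_exp_mul_div_pow (3 * k) (r := r) (by omega)
    refine (mul_le_mul_of_nonneg_right h2 (by positivity)).trans ?_
    rw [← mul_pow]
    refine pow_le_pow_left₀ (by positivity) ?_ r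
    rw [mul_div_assoc A]
    refine mul_le_mul_of_nonneg_right ?_ (by positivity)
    rw [div_le_iff₀ hr0, hA, div_mul_eq_mul_div, le_div_iff₀ hε]
    have h3 := mul_le_mul_of_nonneg_left hrk (show 0 ≤ 6 * Real.exp 1 by positivity)
    push_cast
    linarith
  -- `n ≥ 60 k / ε` gives `A k / n ≤ e / 10`.
  have h4 : A * k / n ≤ 1 / 2 := by
    rw [div_le_iff₀ hn0']
    rw [div_le_iff₀ hε] at hn
    rw [hA, div_mul_eq_mul_div, div_le_iff₀ hε]
    have h5 := Real.exp_one_lt_three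
    have h6 : 6 * Real.exp 1 * k ≤ 18 * k := mul_le_mul_of_nonneg_right (by linarith) hk0'.le
    linarith
  have h7 : ((C.eval n : ℕ) : ℝ) ≤ C.eval 1 * (n : ℝ) ^ d := by exact_mod_cast eval_le_mul_pow C hn0
  -- `d` of the `r` factors `A k / n` absorb `n ^ d`; the others are at most `1 / 2` each.
  calc ((C.eval n : ℕ) : ℝ) * ((3 * k).choose r * ((k : ℝ) / n) ^ r)
      ≤ (((C.eval 1 : ℕ) : ℝ) * (n : ℝ) ^ d) * (A * k / n) ^ r := by gcongr
    _ = ((C.eval 1 : ℕ) : ℝ) * (A * k) ^ d * (A * k / n) ^ (r - d) := by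
        rw [← Nat.sub_add_cancel hd, pow_add, Nat.add_sub_cancel, div_pow _ _ d]
        field_simp
    _ ≤ ((C.eval 1 : ℕ) : ℝ) * (A * (2 / ε * r)) ^ d * (1 / 2) ^ (r - d) := by gcongr
    _ = ((C.eval 1 : ℕ) : ℝ) * (A * (2 / ε)) ^ d * 2 ^ d * ((r : ℝ) ^ d * (1 / 2) ^ r) := by
        have h8 : (1 / 2 : ℝ) ^ r * 2 ^ d = (1 / 2) ^ (r - d) := by
          conv_lhs => rw [← Nat.sub_add_cancel hd, pow_add, mul_assoc, ← mul_pow]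
          norm_num
        rw [← h8, ← mul_assoc A, mul_pow (A * (2 / ε))]
        generalize (A * (2 / ε)) ^ d = B
        generalize (1 / 2 : ℝ) ^ r = y
        ring

theorem exists_hard_instance {κ : ℝ} (hκ_pos : 0 < κ) (hκ_le : κ ≤ 1) {ε : ℝ} (hε : 0 < ε)
    (C : ℕ[X]) : ∃ k₀ : ℕ, ∀ k : ℕ, k₀ ≤ k → ∀ p : ℕ, k ≤ p →
      ∀ A : RandAlg (Fin ⌈60 * (p : ℝ) / ε⌉₊),
        A.IsPruner κ (C.eval ⌈60 * (p : ℝ) / ε⌉₊) p →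
          ∃ f : Finset (Fin ⌈60 * (p : ℝ) / ε⌉₊) → ℝ, IsBoundedCurvature κ f ∧
            A.expectedContainedValue f k < (1 - κ / Real.exp 1 + ε) * opt f k := by
  rcases lt_or_ge (κ / Real.exp 1) ε with hbig | hsmall
  · -- The factor exceeds `1`: every function with positive optimum will do.
    refine ⟨1, fun k hk p hkp A _ => ⟨hiddenFun κ k 0 ∅,
      isBoundedCurvature_hiddenFun hκ_pos.le hκ_le hk 0 (by simp), ?_⟩⟩
    have hp : (0 : ℝ) < p := by exact_mod_cast (show 0 < p by omega)
    have hn : 0 < ⌈60 * (p : ℝ) / ε⌉₊ := Nat.ceil_pos.2 (by positivity)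
    have h1 : hiddenFun κ k 0 ∅ {(⟨0, hn⟩ : Fin ⌈60 * (p : ℝ) / ε⌉₊)} ≤
        opt (hiddenFun κ k 0 ∅) k := le_optWithin (Finset.subset_univ _) (by simpa using hk)
    rw [hiddenFun_singleton κ hk] at h1
    have h2 : (0 : ℝ) < 1 / k := by
      have : (0 : ℝ) < k := by exact_mod_cast hk
      positivity
    refine (A.expectedContainedValue_le_opt _ k).trans_lt ?_
    exact lt_mul_of_one_lt_left (h2.trans_le h1) (by linarith)
  have hε1 : ε ≤ 1 := by
    refine hsmall.trans ((div_le_one (Real.exp_pos 1)).2 (hκ_le.trans ?_))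
    linarith [Real.add_one_le_exp (1 : ℝ)]
  have hpow : ∀ᶠ k : ℕ in atTop, 1 / Real.exp 1 - ε / 8 ≤ (1 - 1 / (k : ℝ)) ^ k := by
    have h := Real.tendsto_one_add_div_pow_exp (-1)
    rw [Real.exp_neg, ← one_div] at h
    filter_upwards [h.eventually (eventually_ge_nhds
      (show 1 / Real.exp 1 - ε / 8 < 1 / Real.exp 1 by linarith))] with k hk
    rwa [neg_div, ← sub_eq_add_neg] at hk
  obtain ⟨k₀, hk₀⟩ := eventually_atTop.1 ((hpow.and (eventually_eval_mul_choose_le hε C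
    (show 0 < ε / 8 by linarith))).and (eventually_gt_atTop 0))
  refine ⟨k₀, fun k hk p hkp => ?_⟩
  obtain ⟨⟨hq, htail⟩, hk0⟩ := hk₀ k hk
  set n := ⌈60 * (p : ℝ) / ε⌉₊ with hn
  intro A hA
  set t := ⌊ε * k / 2⌋₊ with ht
  have hk0' : (0 : ℝ) < k := by exact_mod_cast hk0
  have hkp' : (k : ℝ) ≤ p := by exact_mod_cast hkp
  have hpn : 60 * (p : ℝ) / ε ≤ n := Nat.le_ceil _
  have hpn' : 60 * (p : ℝ) ≤ n * ε := (div_le_iff₀ hε).1 hpn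
  have hkn : 60 * (k : ℝ) / ε ≤ n := le_trans (by gcongr) hpn
  have hn0 : (0 : ℝ) < n := lt_of_lt_of_le (by positivity) hkn
  have hkn' : k ≤ n := by
    have h1 : (n : ℝ) * ε ≤ n * 1 := mul_le_mul_of_nonneg_left hε1 hn0.le
    have h2 : (k : ℝ) ≤ n := by linarith
    exact_mod_cast h2
  have htk : (t : ℝ) ≤ ε * k / 2 := Nat.floor_le (by positivity)
  have htk' : t ≤ k := by
    have h1 : ε * k ≤ 1 * k := mul_le_mul_of_nonneg_right hε1 hk0'.le
    have h2 : (t : ℝ) ≤ k := by linarith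
    exact_mod_cast h2
  obtain ⟨O, hO, hE⟩ := A.exists_hiddenFun_le hA hκ_pos.le hκ_le hk0 (by simpa using hkn') t
  rw [Fintype.card_fin] at hE
  refine ⟨hiddenFun κ k t O, isBoundedCurvature_hiddenFun hκ_pos.le hκ_le hk0 t hO.le, ?_⟩
  have hopt : 1 - ε / 2 ≤ opt (hiddenFun κ k t O) k := by
    refine le_trans ?_ ((le_hiddenFun_self hκ_le hk0 htk' hO).trans
      (le_optWithin (Finset.subset_univ _) hO.le))
    have : (t : ℝ) / k ≤ ε / 2 := by
      rw [div_le_iff₀ hk0']; linarith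
    linarith
  have h1 := htail n hkn
  have h2 : κ * ((p : ℝ) / n) ≤ ε / 60 := by
    have h3 : (p : ℝ) / n ≤ ε / 60 := by
      rw [div_le_iff₀ hn0]; linarith
    exact (mul_le_mul_of_nonneg_left h3 hκ_pos.le).trans
      (mul_le_of_le_one_left (by positivity) hκ_le)
  have h4 : κ / Real.exp 1 - ε / 8 ≤ κ * (1 - 1 / (k : ℝ)) ^ k := by
    have h5 := mul_le_mul_of_nonneg_left hq hκ_pos.le
    have h6 : κ * (ε / 8) ≤ 1 * (ε / 8) := mul_le_mul_of_nonneg_right hκ_le (by positivity)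
    have h7 : κ / Real.exp 1 = κ * (1 / Real.exp 1) := by ring
    rw [h7]
    linarith
  have h8 : κ / Real.exp 1 ≤ 1 := (div_le_one (Real.exp_pos 1)).2
    (hκ_le.trans (by linarith [Real.add_one_le_exp (1 : ℝ)]))
  have h9 : 0 ≤ 1 - κ / Real.exp 1 + ε := by linarith
  have h10 := mul_le_mul_of_nonneg_left hopt h9
  have h11 : (1 - κ / Real.exp 1 + ε) * (ε / 2) ≤ 1 * (ε / 2) :=
    mul_le_mul_of_nonneg_right (by linarith) (by positivity)
  linarith

end Asymptotics

theorem mainTheorem5 (κ : ℝ) (hκ_pos : 0 < κ) (hκ_le : κ ≤ 1) :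
    -- hardness at every pruning budget `p ≥ k`
    (∀ ε : ℝ, 0 < ε → ∀ C : ℕ[X], ∃ k₀ : ℕ, ∀ k : ℕ, k₀ ≤ k → ∀ p : ℕ, k ≤ p →
      ∀ A : RandAlg (Fin ⌈60 * (p : ℝ) / ε⌉₊),
        A.IsPruner κ (C.eval ⌈60 * (p : ℝ) / ε⌉₊) p →
          ∃ f : Finset (Fin ⌈60 * (p : ℝ) / ε⌉₊) → ℝ, IsBoundedCurvature κ f ∧
            A.expectedContainedValue f k < (1 - κ / Real.exp 1 + ε) * opt f k) ∧
    -- tightness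
    (∀ δ : ℝ, 0 < δ → ∃ C : ℕ[X], ∀ n k p : ℕ, k ≤ p →
      ∃ A : RandAlg (Fin n), A.IsPruner κ (C.eval n) p ∧
        ∀ f : Finset (Fin n) → ℝ, IsBoundedCurvature κ f →
          (1 - κ / Real.exp 1 - δ) * opt f k ≤ A.expectedContainedValue f k) ∧
    -- curvature zero: modularity and exact containment
    (∀ n k p : ℕ, k ≤ p → ∃ A : QueryAlg (Fin n),
      ∀ f : Finset (Fin n) → ℝ, IsBoundedCurvature 0 f →
        IsModular f ∧ A.numQueries f ≤ n ∧ (A.run f).card ≤ p ∧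
          ∀ k' : ℕ, k' ≤ k → optWithin f (A.run f) k' = opt f k') := by
  exact ⟨fun _ hε C => exists_hard_instance hκ_pos hκ_le hε C,
    fun _ hδ => exists_pruning_of_approx hδ hκ_pos.le hκ_le, exists_exact_pruning⟩
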